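/- Let $E$ be the space of complex column vectors $(x_n)_{n\ge 1}$ with finitely many nonzero entries and let $\mathcal A=\operatorname{End}_{\mathbf C}(E)$, identified with the ring of column-finite matrices indexed by the positive integers. $\mathcal A$ acts on the right on complex sequences by $(fA)(n)=\sum_m a_{m,n}f(m)$; a sequence $f$ is identified with the Dirichlet series $\sum_n f(n)n^{-s}$, and $1$ denotes the series with the single term $1^{-s}$. Let $S=\begin{pmatrix}0&-1\\1&0\end{pmatrix}$ and $T=\begin{pmatrix}1&1\\0&1\end{pmatrix}$ in $\mathrm{SL}(2,\mathbf Z)$. Let $\rho:\mathrm{SL}(2,\mathbf Z)\to\mathcal A^\times$ be the following representation. * Let $b_0=b_1=1$ and $b_n=-\sum_{i,j\ge1,\ i+j=n}b_ib_j$ for $n\ge2$. Put $B_0=T$, $B_1=\begin{pmatrix}0&1\\1&1\end{pmatrix}$ and $B_n=\begin{pmatrix}0&b_n\\b_n&0\end{pmatrix}$ for $n\ge2$. Let $\tilde J\in\mathcal A$ be the block upper triangular matrix of $2\times2$ blocks whose $(k,l)$ block is $B_{l-k}$ for $k\le l$ and $0$ for $k>l$, and let $\tilde S=\operatorname{diag}(S,S,\dots)$.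 Let $\tau_1$ be the unique homomorphism $\mathrm{SL}(2,\mathbf Z)\to\mathcal A^\times$ with $\tau_1(S)=\tilde S$ and $\tau_1(T)=\tilde J$. * Let $P$ be the upper unitriangular matrix whose $n$-th row is the first row of $(\tilde J-I)^{n-1}$, and let $\tau(Y)=P\tau_1(Y)P^{-1}$. * For $A\in\mathcal A$ let $\psi(A)\in\mathcal A$ be the matrix whose $(2^{k-1}d,2^{l-1}d)$ entry is $A_{k,l}$ for all $k,l\ge1$ and all odd $d\ge1$, and whose other entries are $0$. * Let $D=(d_{i,j})$ be the divisor matrix, $d_{i,j}=1$ if $i\mid j$ and $d_{i,j}=0$ otherwise. Let $Z$ be the upper unitriangular matrix whose $2^kd$-th row ($k\ge0$, $d$ odd) is the $d$-th row of $(D-I)^k$. Put $\rho(Y)=Z^{-1}\psi(\tau(Y))Z$. Then $\rho(T)=D$, so that $1\cdot\rho(T)=\zeta(s)$ and the orbit of $1$ under $\rho(\mathrm{SL}(2,\mathbf Z))$ is the orbit of $\zeta(s)$. **Theorem.** Let $\varphi(s)=1\cdot\rho(-S)=\sum_{n\ge1}a_nn^{-s}$, where $a_n=\rho(-S)_{1,n}$,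 and let $\sigma_c$ be its abscissa of (conditional) convergence. Then $\sigma_c<\infty$, and for every complex $s$ with $\operatorname{Re}(s)>\max(1,\sigma_c)$ the series $\varphi(s)$ converges and $$(\zeta(s)-1)\varphi(s)^2+\zeta(s)\varphi(s)-\zeta(s)(\zeta(s)-1)=0 .$$ -/

import Mathlib

open scoped MatrixGroups
open Filter Topology

namespace DivisorMatrix

/-! ### The presentation of the modular group -/

/-- Positive words in the letters `x * y` and `x * y * y`. -/
inductive Word {𝒢 : Type*} [Group 𝒢] (x y : 𝒢) : 𝒢 → Prop
  | one : Word x y 1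
  | consU (w : 𝒢) : Word x y w → Word x y (x * y * w)
  | consL (w : 𝒢) : Word x y w → Word x y (x * y * y * w)

theorem Word.matrix {𝒢 : Type*} [Group 𝒢] {x y : 𝒢} (π : 𝒢 →* SL(2, ℤ))
    (hx : π x = ModularGroup.S) (hy : π y = ModularGroup.S * ModularGroup.T) {w : 𝒢}
    (hw : Word x y w) :
    ∃ a b c d ε : ℤ, (ε = 1 ∨ ε = -1) ∧ 1 ≤ a ∧ 0 ≤ b ∧ 0 ≤ c ∧ 1 ≤ d ∧ (w = 1 ∨ 1 ≤ b + c) ∧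
      (π w : Matrix (Fin 2) (Fin 2) ℤ) = !![ε * a, ε * b; ε * c, ε * d] := by
  induction hw with
  | one => exact ⟨1, 0, 0, 1, 1, by simp [Matrix.one_fin_two]⟩
  | consU w _ ih =>
    obtain ⟨a, b, c, d, ε, hε, ha, hb, hc, hd, -, h⟩ := ih
    refine ⟨a + c, b + d, c, d, -ε, by omega, by omega, by omega, by omega, by omega,
      Or.inr (by omega), ?_⟩
    rw [map_mul, map_mul, hx, hy, Matrix.SpecialLinearGroup.coe_mul, h]
    simp only [Matrix.SpecialLinearGroup.coe_mul, ModularGroup.coe_S, ModularGroup.coe_T,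
      Matrix.mul_fin_two]
    ext i j
    fin_cases i <;> fin_cases j <;> simp <;> ring
  | consL w _ ih =>
    obtain ⟨a, b, c, d, ε, hε, ha, hb, hc, hd, -, h⟩ := ih
    refine ⟨a, b, a + c, b + d, -ε, by omega, by omega, by omega, by omega, by omega,
      Or.inr (by omega), ?_⟩
    rw [map_mul, map_mul, map_mul, hx, hy, Matrix.SpecialLinearGroup.coe_mul, h]
    simp only [Matrix.SpecialLinearGroup.coe_mul, ModularGroup.coe_S, ModularGroup.coe_T,
      Matrix.mul_fin_two]
    ext i j
    fin_cases i <;> fin_cases j <;> simp <;> ring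

theorem exists_normalForm {𝒢 : Type*} [Group 𝒢] {x y : 𝒢} (h4 : x ^ 4 = 1) (h3 : y ^ 3 = x ^ 2)
    {g : 𝒢} (hg : g ∈ Subgroup.closure {x, y}) :
    ∃ (e a b : ℕ) (w : 𝒢), Word x y w ∧ a < 3 ∧ b < 2 ∧ g = (x ^ 2) ^ e * y ^ a * w * x ^ b := by
  have hzx : Commute x (x ^ 2) := Commute.self_pow x 2
  have hzy : Commute y (x ^ 2) := h3 ▸ Commute.self_pow y 3
  let NF : 𝒢 → Prop := fun g => ∃ (e a b : ℕ) (w : 𝒢), Word x y w ∧ a < 3 ∧ b < 2 ∧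
    g = (x ^ 2) ^ e * y ^ a * w * x ^ b
  have hY : ∀ g, NF g → NF (y * g) := by
    rintro _ ⟨e, a, b, w, hw, ha, hb, rfl⟩
    have h1 : y * ((x ^ 2) ^ e * y ^ a * w * x ^ b) = (x ^ 2) ^ e * y ^ (a + 1) * w * x ^ b := by
      rw [pow_succ' y a]
      simp only [← mul_assoc]
      rw [(hzy.pow_right e).eq]
    rw [h1]
    by_cases h : a + 1 < 3
    · exact ⟨e, a + 1, b, w, hw, h, hb, rfl⟩
    · obtain rfl : a = 2 := by omega
      exact ⟨e + 1, 0, b, w, hw, by omega, hb, by rw [h3, ← pow_succ, pow_zero, mul_one]⟩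
  have hX : ∀ g, NF g → NF (x * g) := by
    rintro _ ⟨e, a, b, w, hw, ha, hb, rfl⟩
    have h1 : x * ((x ^ 2) ^ e * y ^ a * w * x ^ b) = (x ^ 2) ^ e * (x * y ^ a * w) * x ^ b := by
      simp only [← mul_assoc]
      rw [(hzx.pow_right e).eq]
    rw [h1]
    have hcase : a = 0 ∨ a = 1 ∨ a = 2 := by omega
    rcases hcase with rfl | rfl | rfl
    · cases hw with
      | one =>
        have hb' : b = 0 ∨ b = 1 := by omega
        rcases hb' with rfl | rfl
        · exact ⟨e, 0, 1, 1, .one, by omega, by omega, by simp⟩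
        · exact ⟨e + 1, 0, 0, 1, .one, by omega, by omega, by
            rw [pow_succ (x ^ 2) e, pow_two x]; simp [mul_assoc]⟩
      | consU w hw =>
        exact ⟨e + 1, 1, b, w, hw, by omega, hb, by
          rw [pow_succ (x ^ 2) e, pow_two x]; simp [mul_assoc]⟩
      | consL w hw =>
        exact ⟨e + 1, 2, b, w, hw, by omega, hb, by
          rw [pow_succ (x ^ 2) e, pow_two x]; simp [pow_two y, mul_assoc]⟩
    · exact ⟨e, 0, b, _, .consU w hw, by omega, hb, by simp⟩
    · exact ⟨e, 0, b, _, .consL w hw, by omega, hb, by simp [pow_two y, mul_assoc]⟩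
  have hx' : x⁻¹ = x * (x * x) := by
    rw [inv_eq_iff_mul_eq_one, ← h4]; simp only [pow_succ, pow_zero, one_mul, mul_assoc]
  have hy' : y⁻¹ = y * (y * (y * (y * y))) := by
    have h6 : y ^ 6 = 1 := by
      calc y ^ 6 = (y ^ 3) ^ 2 := by group
        _ = x ^ 4 := by rw [h3]; group
        _ = 1 := h4
    rw [inv_eq_iff_mul_eq_one, ← h6]; simp only [pow_succ, pow_zero, one_mul, mul_assoc]
  change NF g
  induction hg using Subgroup.closure_induction_left with
  | one => exact ⟨0, 0, 0, 1, .one, by omega, by omega, by simp⟩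
  | mul_left u hu v _ ih =>
    rcases hu with rfl | rfl
    · exact hX _ ih
    · exact hY _ ih
  | inv_mul_cancel u hu v _ ih =>
    rcases hu with rfl | rfl
    · rw [hx', mul_assoc, mul_assoc]; exact hX _ (hX _ (hX _ ih))
    · simp only [hy', mul_assoc]; exact hY _ (hY _ (hY _ (hY _ (hY _ ih))))

theorem eq_one_of_map_eq_one {𝒢 : Type*} [Group 𝒢] {x y : 𝒢} (h4 : x ^ 4 = 1)
    (h3 : y ^ 3 = x ^ 2) (π : 𝒢 →* SL(2, ℤ)) (hx : π x = ModularGroup.S)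
    (hy : π y = ModularGroup.S * ModularGroup.T) {g : 𝒢} (hg : g ∈ Subgroup.closure {x, y})
    (h1 : π g = 1) : g = 1 := by
  obtain ⟨e, p, q, w, hw, hp, hq, rfl⟩ := exists_normalForm h4 h3 hg
  obtain ⟨a, b, c, d, ε, hε, ha, hb, hc, hd, hw1, hM⟩ := hw.matrix π hx hy
  have hz : ∃ δ : ℤ, (δ = 1 ∧ (x ^ 2) ^ e = 1 ∨ δ = -1) ∧
      (π ((x ^ 2) ^ e) : Matrix (Fin 2) (Fin 2) ℤ) = !![δ, 0; 0, δ] := by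
    have hS : (ModularGroup.S ^ 2 : SL(2, ℤ)) = -1 := by decide
    rcases Nat.even_or_odd' e with ⟨k, rfl | rfl⟩
    · have : (x ^ 2) ^ (2 * k) = 1 := by
        rw [← pow_mul, show 2 * (2 * k) = 4 * k by ring, pow_mul, h4, one_pow]
      exact ⟨1, Or.inl ⟨rfl, this⟩, by rw [this]; simp [Matrix.one_fin_two]⟩
    · refine ⟨-1, Or.inr rfl, ?_⟩
      rw [map_pow, map_pow, hx, hS, pow_succ, pow_mul]
      simp [Matrix.one_fin_two]
  obtain ⟨δ, hδ, hzM⟩ := hz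
  have h2 := congrArg (fun A : SL(2, ℤ) => (A : Matrix (Fin 2) (Fin 2) ℤ)) h1
  simp only [map_mul, Matrix.SpecialLinearGroup.coe_mul, hzM, hM, map_pow π y, map_pow π x, hx, hy,
    Matrix.SpecialLinearGroup.coe_pow, Matrix.SpecialLinearGroup.coe_one] at h2
  have hp' : p = 0 ∨ p = 1 ∨ p = 2 := by omega
  have hq' : q = 0 ∨ q = 1 := by omega
  have hδ' : δ = 1 ∨ δ = -1 := hδ.imp And.left id
  have e00 := congrFun (congrFun h2 0) 0
  have e01 := congrFun (congrFun h2 0) 1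
  have e10 := congrFun (congrFun h2 1) 0
  have e11 := congrFun (congrFun h2 1) 1
  rcases hp' with rfl | rfl | rfl <;> rcases hq' with rfl | rfl <;>
    simp [pow_two, Matrix.one_fin_two] at e00 e01 e10 e11
  · have hb0 : b = 0 := by rcases hδ' with rfl | rfl <;> rcases hε with rfl | rfl <;> omega
    have hc0 : c = 0 := by rcases hδ' with rfl | rfl <;> rcases hε with rfl | rfl <;> omega
    obtain rfl : w = 1 := hw1.resolve_right (by omega)
    have hw0 : ε * a = 1 := by
      have := congrFun (congrFun hM 0) 0
      simpa using this.symm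
    rcases hδ with ⟨-, h⟩ | rfl
    · simp [h]
    · rcases hε with rfl | rfl <;> omega
  all_goals
    exfalso
    rcases hδ' with rfl | rfl <;> rcases hε with rfl | rfl <;> omega

/-- `SL(2, ℤ)` is presented by the generators `S`, `T` and the relations
`S ^ 4 = 1`, `(S * T) ^ 3 = S ^ 2`. -/
theorem existsUnique_lift {H : Type*} [Group H] (s t : H) (h4 : s ^ 4 = 1)
    (h3 : (s * t) ^ 3 = s ^ 2) :
    ∃! f : SL(2, ℤ) →* H, f ModularGroup.S = s ∧ f ModularGroup.T = t := by
  let x : SL(2, ℤ) × H := (ModularGroup.S, s)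
  let y : SL(2, ℤ) × H := (ModularGroup.S * ModularGroup.T, s * t)
  have hx4 : x ^ 4 = 1 := Prod.ext (show ModularGroup.S ^ 4 = 1 by decide) h4
  have hy3 : y ^ 3 = x ^ 2 := Prod.ext (show (ModularGroup.S * ModularGroup.T) ^ 3 = ModularGroup.S ^ 2 by decide) h3
  let K : Subgroup (SL(2, ℤ) × H) := Subgroup.closure {x, y}
  have hxK : x ∈ K := Subgroup.subset_closure (by simp)
  have hyK : y ∈ K := Subgroup.subset_closure (by simp)
  have htK : (ModularGroup.T, t) ∈ K := by
    have : (ModularGroup.T, t) = x⁻¹ * y := Prod.ext (by simp [x, y]) (by simp [x, y])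
    rw [this]
    exact K.mul_mem (K.inv_mem hxK) hyK
  let p : K →* SL(2, ℤ) := (MonoidHom.fst _ _).comp K.subtype
  have hinj : Function.Injective p := by
    rw [injective_iff_map_eq_one]
    rintro ⟨g, hg⟩ h
    exact Subtype.ext (eq_one_of_map_eq_one hx4 hy3 (MonoidHom.fst _ _) rfl rfl hg h)
  have hsurj : Function.Surjective p := by
    rw [← MonoidHom.range_eq_top, eq_top_iff,
      ← SpecialLinearGroup.SL2Z_generators, Subgroup.closure_le]
    rintro g (rfl | rfl)
    · exact ⟨⟨_, hxK⟩, rfl⟩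
    · exact ⟨⟨_, htK⟩, rfl⟩
  let φ : K ≃* SL(2, ℤ) := MulEquiv.ofBijective p ⟨hinj, hsurj⟩
  refine ⟨((MonoidHom.snd _ _).comp K.subtype).comp φ.symm.toMonoidHom, ⟨?_, ?_⟩, ?_⟩
  · have : φ.symm ModularGroup.S = ⟨_, hxK⟩ := (MulEquiv.symm_apply_eq φ).2 rfl
    simp [this, x]
  · have : φ.symm ModularGroup.T = ⟨_, htK⟩ := (MulEquiv.symm_apply_eq φ).2 rfl
    simp [this]
  · rintro f ⟨hfS, hfT⟩
    refine MonoidHom.eq_of_eqOn_dense SpecialLinearGroup.SL2Z_generators ?_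
    rintro g (rfl | rfl)
    · have : φ.symm ModularGroup.S = ⟨_, hxK⟩ := (MulEquiv.symm_apply_eq φ).2 rfl
      simp [hfS, this, x]
    · have : φ.symm ModularGroup.T = ⟨_, htK⟩ := (MulEquiv.symm_apply_eq φ).2 rfl
      simp [hfT, this]

/-! ### Column-finite matrices -/

/-- The space of columns, indexed by the positive integers, with finitely many nonzero entries. -/
abbrev E := ℕ+ →₀ ℂ

/-- The ring of column-finite complex matrices indexed by the positive integers, identified with
the endomorphism ring of `E` acting on the left: the `j`-th column of `A` is the image of the `j`-th
standard basis vector. -/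
abbrev 𝒜 := Module.End ℂ E

/-- The `j`-th standard basis vector. -/
noncomputable abbrev e (j : ℕ+) : E := Finsupp.single j 1

/-- The `(i, j)` entry of a column-finite matrix. -/
noncomputable def entry (A : 𝒜) (i j : ℕ+) : ℂ := A (e j) i

/-- The column-finite matrix with given entries. -/
noncomputable def ofEntries (a : ℕ+ → ℕ+ → ℂ) (h : ∀ j, (Function.support fun i => a i j).Finite) :
    𝒜 :=
  Finsupp.linearCombination ℂ fun j => Finsupp.ofSupportFinite (fun i => a i j) (h j)

@[simp]
theorem entry_ofEntries (a : ℕ+ → ℕ+ → ℂ) (h) (i j : ℕ+) : entry (ofEntries a h) i j = a i j := by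
  simp only [entry, ofEntries, Finsupp.linearCombination_single, one_smul]
  rfl

theorem entry_one (i j : ℕ+) : entry 1 i j = if i = j then 1 else 0 := by
  simp [entry, Finsupp.single_apply, eq_comm]

theorem entry_ext {A B : 𝒜} (h : ∀ i j, entry A i j = entry B i j) : A = B := by
  refine Finsupp.lhom_ext' fun j => LinearMap.ext_ring ?_
  ext i
  exact h i j

theorem apply_e (B : 𝒜) (j : ℕ+) (s : Finset ℕ+) (hs : ∀ m, entry B m j ≠ 0 → m ∈ s) :
    B (e j) = ∑ m ∈ s, entry B m j • e m := by
  ext i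
  simp only [Finsupp.coe_finsetSum, Finset.sum_apply, Finsupp.smul_apply, Finsupp.single_apply,
    smul_eq_mul, mul_ite, mul_one, mul_zero, Finset.sum_ite_eq']
  split_ifs with hi
  · rfl
  · by_contra h
    exact hi (hs i h)

theorem entry_mul (A B : 𝒜) (i j : ℕ+) (s : Finset ℕ+) (hs : ∀ m, entry B m j ≠ 0 → m ∈ s) :
    entry (A * B) i j = ∑ m ∈ s, entry A i m * entry B m j := by
  rw [entry, Module.End.mul_apply, apply_e B j s hs]
  simp only [map_sum, map_smul, Finsupp.coe_finsetSum, Finset.sum_apply, Finsupp.smul_apply,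
    smul_eq_mul]
  exact Finset.sum_congr rfl fun m _ => mul_comm _ _

/-- The right action of column-finite matrices on sequences: `(f A)(n) = ∑ m, a m n * f m`. -/
noncomputable def act (f : ℕ+ → ℂ) (A : 𝒜) (n : ℕ+) : ℂ := (A (e n)).sum fun m a => a * f m

/-- The entries of `A` vanish at `(i, j)` for `j < c i`, and are equal to `1` at `(i, c i)`. -/
def Leads (A : 𝒜) (c : ℕ+ → ℕ+) : Prop :=
  ∀ i, entry A i (c i) = 1 ∧ ∀ j, j < c i → entry A i j = 0

theorem Leads.mul {A B : 𝒜} {c c' : ℕ+ → ℕ+} (hA : Leads A c) (hB : Leads B c')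
    (hc' : StrictMono c') : Leads (A * B) (c' ∘ c) := by
  intro i
  have key : ∀ m j, j ≤ c' (c i) → m ≠ c i ∨ j < c' (c i) → entry A i m * entry B m j = 0 := by
    intro m j hj h
    rcases lt_trichotomy m (c i) with hm | rfl | hm
    · rw [(hA i).2 m hm, zero_mul]
    · rw [(hB _).2 j (h.resolve_left (by simp)), mul_zero]
    · rw [(hB m).2 j (hj.trans_lt (hc' hm)), mul_zero]
  constructor
  · rw [entry_mul A B i _ (insert (c i) (B (e ((c' ∘ c) i))).support)
      (fun m hm => Finset.mem_insert_of_mem (by simpa [entry] using hm)),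
      Finset.sum_eq_single (c i)]
    · simp [(hA i).1, (hB (c i)).1]
    · exact fun m _ hm => key m _ le_rfl (Or.inl hm)
    · simp
  · intro j hj
    rw [entry_mul A B i j (B (e j)).support (fun m hm => by simpa [entry] using hm)]
    exact Finset.sum_eq_zero fun m _ => key m j hj.le (Or.inr hj)

theorem Leads.one : Leads 1 id := fun i =>
  ⟨by simp [entry_one], fun j hj => by simp only [id] at hj; simp [entry_one, hj.ne']⟩

theorem Leads.pow {A : 𝒜} {c : ℕ+ → ℕ+} (hA : Leads A c) (hc : StrictMono c) (k : ℕ) :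
    Leads (A ^ k) c^[k] := by
  induction k with
  | zero => exact Leads.one
  | succ k ih =>
    rw [pow_succ, Function.iterate_succ']
    exact ih.mul hA hc

/-- Upper triangular entries define a column-finite matrix. -/
theorem finite_support_of_upper {a : ℕ+ → ℕ+ → ℂ} (h : ∀ i j, j < i → a i j = 0) (j : ℕ+) :
    (Function.support fun i => a i j).Finite :=
  (Set.finite_Iic j).subset fun i hi => by
    by_contra hij
    exact hi (h i j (not_le.1 hij))

theorem Leads.isUnit {A : 𝒜} (hA : Leads A id) : IsUnit A := by
  rw [Module.End.isUnit_iff]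
  constructor
  · rw [injective_iff_map_eq_zero]
    intro f hf
    by_contra h0
    have hne : f.support.Nonempty := by simpa [Finsupp.support_nonempty_iff] using h0
    set j := f.support.max' hne with hj
    have hjs : j ∈ f.support := Finset.max'_mem _ _
    have h1 : A f j = f j := by
      conv_lhs => rw [← Finsupp.sum_single f]
      rw [Finsupp.sum, map_sum, Finsupp.coe_finsetSum, Finset.sum_apply, Finset.sum_eq_single j]
      · have : Finsupp.single j (f j) = f j • e j := by simp
        rw [this, map_smul, Finsupp.smul_apply]
        have := (hA j).1
        simp only [entry, id] at this
        simp [this]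
      · intro m hm hmj
        have hlt : m < j := lt_of_le_of_ne (Finset.le_max' _ _ hm) hmj
        have : Finsupp.single m (f m) = f m • e m := by simp
        rw [this, map_smul, Finsupp.smul_apply]
        have := (hA j).2 m hlt
        simp only [entry] at this
        simp [this]
      · exact fun h => absurd hjs h
    rw [hf] at h1
    exact (Finsupp.mem_support_iff.1 hjs) h1.symm
  · have he : ∀ j, e j ∈ LinearMap.range A := by
      intro j
      induction j using PNat.strongInductionOn with
      | _ j ih =>
        have h := apply_e A j (Finset.Iic j) fun m hm => by
          by_contra hmj
          exact hm ((hA m).2 j (by simpa using hmj))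
        have h1 : entry A j j = 1 := (hA j).1
        rw [← Finset.Iio_insert, Finset.sum_insert (by simp), h1, one_smul] at h
        rw [← sub_eq_iff_eq_add] at h
        rw [← h]
        refine Submodule.sub_mem _ ⟨_, rfl⟩ (Submodule.sum_mem _ fun m hm => ?_)
        exact Submodule.smul_mem _ _ (ih m (by simpa using hm))
    rw [← LinearMap.range_eq_top, eq_top_iff]
    intro f _
    rw [← Finsupp.sum_single f]
    refine Submodule.sum_mem _ fun j _ => ?_
    have : Finsupp.single j (f j) = f j • e j := by simp
    rw [this]
    exact Submodule.smul_mem _ _ (he j)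

/-! ### The divisor matrix and its Jordan form -/

theorem upper_D (i j : ℕ+) (hij : j < i) : (if (i : ℕ) ∣ j then (1 : ℂ) else 0) = 0 :=
  if_neg fun h => (not_le.2 hij) (Nat.le_of_dvd j.pos h)

/-- The divisor matrix: the `(i, j)` entry is `1` if `i ∣ j`, and `0` otherwise. -/
noncomputable def D : 𝒜 :=
  ofEntries (fun i j => if (i : ℕ) ∣ j then 1 else 0) (finite_support_of_upper upper_D)

theorem leads_D_sub_one : Leads (D - 1) fun i => 2 * i := by
  have hD : ∀ i j, entry (D - 1) i j = (if (i : ℕ) ∣ j then 1 else 0) - (if i = j then 1 else 0) := by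
    intro i j
    rw [← entry_one i j, ← entry_ofEntries (fun i j : ℕ+ => if (i : ℕ) ∣ j then (1 : ℂ) else 0)
      (finite_support_of_upper upper_D) i j]
    rfl
  intro i
  refine ⟨?_, fun j hj => ?_⟩
  · have h : i ≠ 2 * i := by
      intro h
      have := congrArg PNat.val h
      simp only [PNat.mul_coe, PNat.val_ofNat] at this
      have := i.pos
      omega
    rw [hD, if_pos (PNat.dvd_iff.1 (Dvd.intro_left _ rfl)), if_neg h, sub_zero]
  · rw [hD]
    by_cases hij : i = j
    · simp [hij]
    · rw [if_neg hij, if_neg, sub_zero]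
      rw [← PNat.dvd_iff]
      rintro ⟨k, rfl⟩
      have hk1 : k ≠ 1 := by rintro rfl; simp at hij
      have : 2 ≤ k := by
        rw [← PNat.coe_le_coe]
        have h1 := k.pos
        have h2 : (k : ℕ) ≠ 1 := fun h => hk1 (PNat.coe_eq_one_iff.1 h)
        simp only [PNat.val_ofNat]
        omega
      exact absurd hj (not_lt.2 (show 2 * i ≤ i * k by rw [mul_comm 2 i]; gcongr))

/-- The exponent of `2` in `i`. -/
def twoVal (i : ℕ+) : ℕ := padicValNat 2 i

/-- The odd part of `i`. -/
def oddPart (i : ℕ+) : ℕ+ := ⟨ordCompl[2] (i : ℕ), Nat.ordCompl_pos 2 i.ne_zero⟩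

theorem two_pow_mul_oddPart (i : ℕ+) : 2 ^ twoVal i * oddPart i = i := by
  apply PNat.eq
  rw [PNat.mul_coe, PNat.pow_coe, twoVal, ← Nat.factorization_def _ Nat.prime_two]
  exact Nat.ordProj_mul_ordCompl_eq_self _ _

theorem twoVal_two_pow_mul (k : ℕ) (d : ℕ+) (hd : Odd (d : ℕ)) : twoVal (2 ^ k * d) = k := by
  rw [twoVal, PNat.mul_coe, PNat.pow_coe, PNat.val_ofNat,
    padicValNat.mul (by positivity) d.ne_zero, padicValNat.prime_pow,
    padicValNat.eq_zero_of_not_dvd (by rwa [← even_iff_two_dvd, Nat.not_even_iff_odd]), add_zero]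

theorem oddPart_two_pow_mul (k : ℕ) (d : ℕ+) (hd : Odd (d : ℕ)) : oddPart (2 ^ k * d) = d := by
  have h := two_pow_mul_oddPart (2 ^ k * d)
  rw [twoVal_two_pow_mul k d hd] at h
  exact mul_left_cancel h

theorem odd_oddPart (i : ℕ+) : Odd (oddPart i : ℕ) := by
  rw [← Nat.not_even_iff_odd, even_iff_two_dvd]
  exact Nat.not_dvd_ordCompl Nat.prime_two i.ne_zero

theorem upper_Z (i j : ℕ+) (hj : j < i) : entry ((D - 1) ^ twoVal i) (oddPart i) j = 0 := by
  refine ((leads_D_sub_one.pow (fun a b h => by gcongr) (twoVal i)) (oddPart i)).2 j ?_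
  rw [mul_left_iterate]
  change j < 2 ^ twoVal i * oddPart i
  rwa [two_pow_mul_oddPart]

/-- The matrix `Z`: for `i = 2 ^ k * d` with `d` odd, the `i`-th row of `Z` is the `d`-th row of
`(D - 1) ^ k`. -/
noncomputable def Z : 𝒜 :=
  ofEntries (fun i j => entry ((D - 1) ^ twoVal i) (oddPart i) j) (finite_support_of_upper upper_Z)

theorem isUnit_Z : IsUnit Z := by
  refine Leads.isUnit fun i => ⟨?_, fun j hj => ?_⟩
  · have := ((leads_D_sub_one.pow (fun a b h => show 2 * a < 2 * b by gcongr) (twoVal i))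
      (oddPart i)).1
    rw [mul_left_iterate] at this
    change entry _ _ (2 ^ twoVal i * oddPart i) = 1 at this
    rw [two_pow_mul_oddPart] at this
    rw [Z, entry_ofEntries]
    exact this
  · rw [Z, entry_ofEntries]
    exact upper_Z i j hj

/-! ### Block Toeplitz matrices -/

/-- The index of the `2 × 2` block to which the `i`-th row (or column) belongs, from `0`. -/
def blk (i : ℕ+) : ℕ := i.natPred / 2

/-- The position of the `i`-th row (or column) inside its block. -/
def pos (i : ℕ+) : Fin 2 := ⟨i.natPred % 2, Nat.mod_lt _ two_pos⟩

/-- The row with a given block and position. -/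
def unblk (k : ℕ) (c : Fin 2) : ℕ+ := (2 * k + c).succPNat

@[simp] theorem blk_unblk (k : ℕ) (c : Fin 2) : blk (unblk k c) = k := by
  have := c.2
  simp only [blk, unblk, Nat.natPred_succPNat]
  omega

@[simp] theorem pos_unblk (k : ℕ) (c : Fin 2) : pos (unblk k c) = c := by
  have := c.2
  ext
  simp only [pos, unblk, Nat.natPred_succPNat]
  omega

@[simp] theorem unblk_blk_pos (i : ℕ+) : unblk (blk i) (pos i) = i := by
  simp only [blk, unblk, pos]
  rw [Nat.div_add_mod, PNat.succPNat_natPred]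

theorem finite_support_toeplitz (X : ℕ → Matrix (Fin 2) (Fin 2) ℂ) (j : ℕ+) :
    (Function.support fun i : ℕ+ =>
      if blk i ≤ blk j then X (blk j - blk i) (pos i) (pos j) else 0).Finite := by
  refine (Set.finite_Iic (unblk (blk j) 1)).subset fun i hi => ?_
  by_contra h
  refine hi (if_neg ?_)
  simp only [Set.mem_Iic, ← PNat.coe_le_coe, unblk, blk, Nat.succPNat_coe, PNat.natPred] at h ⊢
  simp at h
  omega

/-- The block upper triangular matrix whose `2 × 2` blocks are `X 0, X 1, X 2, …` along the first
block row, repeated down the diagonals. -/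
noncomputable def toeplitz (X : ℕ → Matrix (Fin 2) (Fin 2) ℂ) : 𝒜 :=
  ofEntries (fun i j => if blk i ≤ blk j then X (blk j - blk i) (pos i) (pos j) else 0)
    (finite_support_toeplitz X)

theorem toeplitz_mul (X Y : ℕ → Matrix (Fin 2) (Fin 2) ℂ) :
    toeplitz X * toeplitz Y =
      toeplitz fun n => ∑ p ∈ Finset.HasAntidiagonal.antidiagonal n, X p.1 * Y p.2 := by
  refine entry_ext fun i j => ?_
  let s : Finset ℕ+ := ((Finset.range (blk j + 1)) ×ˢ Finset.univ).image fun p : ℕ × Fin 2 =>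
    unblk p.1 p.2
  rw [entry_mul _ _ i j s, Finset.sum_image, Finset.sum_product]
  · simp only [toeplitz, entry_ofEntries, blk_unblk, pos_unblk]
    split_ifs with h
    · rw [Matrix.sum_apply, Finset.Nat.sum_antidiagonal_eq_sum_range_succ_mk]
      rw [← Finset.sum_subset (s₁ := (Finset.range (blk j - blk i + 1)).map
        (addRightEmbedding (blk i)))]
      · rw [Finset.sum_map]
        refine Finset.sum_congr rfl fun k hk => ?_
        have hk' := Finset.mem_range.1 hk
        simp only [addRightEmbedding_apply, Matrix.mul_apply]
        refine Finset.sum_congr rfl fun c _ => ?_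
        rw [if_pos (by omega), if_pos (by omega), Nat.add_sub_cancel,
          show blk j - (k + blk i) = blk j - blk i - k by omega]
      · intro k hk
        simp only [Finset.mem_map, Finset.mem_range, addRightEmbedding_apply] at hk ⊢
        obtain ⟨a, ha, rfl⟩ := hk
        omega
      · intro k hk hk'
        refine Finset.sum_eq_zero fun c _ => ?_
        rw [if_neg, zero_mul]
        intro hik
        apply hk'
        simp only [Finset.mem_map, Finset.mem_range, addRightEmbedding_apply] at hk ⊢
        exact ⟨k - blk i, by omega, by omega⟩
    · refine Finset.sum_eq_zero fun k hk => Finset.sum_eq_zero fun c _ => ?_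
      have := Finset.mem_range.1 hk
      rw [if_neg (by omega), zero_mul]
  · intro p _ q _ h
    have h1 := congrArg blk h
    have h2 := congrArg pos h
    simp only [blk_unblk, pos_unblk] at h1 h2
    exact Prod.ext h1 h2
  · intro m hm
    simp only [toeplitz, entry_ofEntries] at hm
    refine Finset.mem_image.2 ⟨(blk m, pos m), ?_, unblk_blk_pos m⟩
    simp only [Finset.mem_product, Finset.mem_range, Finset.mem_univ, and_true]
    by_contra h
    exact hm (if_neg (by omega))

/-- Two by two matrices over the formal power series ring act through block Toeplitz matrices. -/
noncomputable def toeplitzHom : Matrix (Fin 2) (Fin 2) (PowerSeries ℂ) →* 𝒜 where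
  toFun M := toeplitz fun n => M.map (PowerSeries.coeff n)
  map_one' := by
    refine entry_ext fun i j => ?_
    rw [toeplitz, entry_ofEntries, entry_one]
    by_cases hij : i = j
    · subst hij
      simp
    · rw [if_neg hij]
      split_ifs with h
      · rw [Matrix.map_apply, Matrix.one_apply]
        split_ifs with hp
        · rw [PowerSeries.coeff_one, if_neg]
          intro h0
          apply hij
          rw [← unblk_blk_pos i, ← unblk_blk_pos j, hp, show blk i = blk j by omega]
        · simp
      · rfl
  map_mul' M N := by
    rw [toeplitz_mul]
    congr 1
    funext n
    ext a c
    simp only [Matrix.map_apply, Matrix.mul_apply, map_sum, PowerSeries.coeff_mul,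
      Matrix.sum_apply]
    exact Finset.sum_comm

theorem toeplitzHom_apply (M : Matrix (Fin 2) (Fin 2) (PowerSeries ℂ)) :
    toeplitzHom M = toeplitz fun n => M.map (PowerSeries.coeff n) := rfl

/-- The integers `b n`: `b 0 = b 1 = 1` and `b n = - ∑ b i * b j` over `i, j ≥ 1` with `i + j = n`,
for `n ≥ 2`. -/
def b : ℕ → ℤ
  | 0 => 1
  | 1 => 1
  | n + 2 => -∑ i : Fin (n + 1), b (i + 1) * b (n + 1 - i)

/-- The blocks of the matrix `Jt`. -/
noncomputable def B : ℕ → Matrix (Fin 2) (Fin 2) ℂ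
  | 0 => !![1, 1; 0, 1]
  | 1 => !![0, 1; 1, 1]
  | n + 2 => !![0, (b (n + 2) : ℂ); (b (n + 2) : ℂ), 0]

/-- The block matrix `J̃`. -/
noncomputable def Jt : 𝒜 := toeplitz B

/-- The block diagonal matrix `S̃ = diag(S, S, …)`. -/
noncomputable def St : 𝒜 :=
  toeplitz fun n => if n = 0 then !![0, -1; 1, 0] else 0

theorem St_eq : St = toeplitzHom !![0, -1; 1, 0] := by
  rw [toeplitzHom_apply, St]
  congr 1
  funext n
  ext a c
  by_cases hn : n = 0 <;> fin_cases a <;> fin_cases c <;> simp [hn, PowerSeries.coeff_one]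

/-- The power series `g` with `1 + g = ∑ b n * t ^ n`. -/
noncomputable def g : PowerSeries ℂ := PowerSeries.mk fun n => if n = 0 then 0 else (b n : ℂ)

theorem g_sq_add_g : g ^ 2 + g = PowerSeries.X := by
  ext n
  rw [pow_two, map_add, PowerSeries.coeff_mul, PowerSeries.coeff_X,
    Finset.Nat.sum_antidiagonal_eq_sum_range_succ_mk]
  simp only [g, PowerSeries.coeff_mk]
  match n with
  | 0 => simp
  | 1 => simp [Finset.sum_range_succ, b]
  | n + 2 =>
    rw [Finset.sum_range_succ, Finset.sum_range_succ', if_neg (by omega : n + 2 ≠ 0),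
      if_neg (by omega : n + 2 ≠ 1)]
    simp only [Nat.sub_self, if_true, mul_zero, zero_mul, add_zero, b, Int.cast_neg, Int.cast_sum,
      Int.cast_mul, Finset.sum_range]
    rw [← sub_eq_add_neg, sub_eq_zero]
    refine Finset.sum_congr rfl fun i _ => ?_
    have := i.2
    rw [if_neg (by omega), if_neg (by omega), show n + 2 - (↑i + 1) = n + 1 - ↑i by omega]

theorem Jt_eq : Jt = toeplitzHom !![1, 1 + g; g, 1 + PowerSeries.X] := by
  rw [toeplitzHom_apply, Jt]
  congr 1
  funext n
  ext a c
  match n with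
  | 0 => fin_cases a <;> fin_cases c <;> simp [B, g]
  | 1 => fin_cases a <;> fin_cases c <;>
      simp [B, g, b, PowerSeries.coeff_one, PowerSeries.coeff_one_X]
  | n + 2 => fin_cases a <;> fin_cases c <;>
      simp [B, g, PowerSeries.coeff_one, PowerSeries.coeff_X]

theorem St_pow_four : St ^ 4 = 1 := by
  rw [St_eq, ← map_pow, ← map_one toeplitzHom]
  congr 1
  simp [pow_succ, Matrix.one_fin_two]

theorem St_mul_Jt_pow_three : (St * Jt) ^ 3 = St ^ 2 := by
  rw [St_eq, Jt_eq, ← map_mul, ← map_pow, ← map_pow]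
  congr 1
  have h := g_sq_add_g
  simp only [pow_succ, pow_zero, one_mul, Matrix.mul_fin_two]
  rw [← h]
  ext1 a c
  fin_cases a <;> fin_cases c <;> simp <;> ring

theorem St_mul_Jt_pow_six : (St * Jt) ^ 6 = 1 := by
  rw [show 6 = 3 * 2 from rfl, pow_mul, St_mul_Jt_pow_three, ← pow_mul, St_pow_four]

/-- `S̃` as an invertible matrix. -/
noncomputable def StUnit : 𝒜ˣ := Units.ofPowEqOne St 4 St_pow_four (by norm_num)

/-- `J̃` as an invertible matrix. -/
noncomputable def JtUnit : 𝒜ˣ :=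
  StUnit⁻¹ * Units.ofPowEqOne (St * Jt) 6 St_mul_Jt_pow_six (by norm_num)

theorem coe_StUnit : (StUnit : 𝒜) = St := rfl

theorem StUnit_mul_JtUnit :
    StUnit * JtUnit = Units.ofPowEqOne (St * Jt) 6 St_mul_Jt_pow_six (by norm_num) := by
  rw [JtUnit, mul_inv_cancel_left]

theorem coe_JtUnit : (JtUnit : 𝒜) = Jt := by
  have h := congrArg (Units.val) StUnit_mul_JtUnit
  rw [Units.val_mul, coe_StUnit] at h
  have hu : IsUnit St := ⟨StUnit, rfl⟩
  exact hu.mul_left_cancel h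

theorem existsUnique_tau₁ : ∃! f : SL(2, ℤ) →* 𝒜ˣ,
    f ModularGroup.S = StUnit ∧ f ModularGroup.T = JtUnit := by
  refine existsUnique_lift StUnit JtUnit (Units.ext ?_) (Units.ext ?_)
  · simpa [coe_StUnit] using St_pow_four
  · simpa [coe_StUnit, coe_JtUnit] using St_mul_Jt_pow_three

/-- The representation `τ₁` of `SL(2, ℤ)`: the unique one with `τ₁(S) = S̃` and `τ₁(T) = J̃`. -/
noncomputable def tau₁ : SL(2, ℤ) →* 𝒜ˣ := existsUnique_tau₁.choose

theorem leads_Jt_sub_one : Leads (Jt - 1) fun i => i + 1 := by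
  have hJ : ∀ i j, entry (Jt - 1) i j =
      (if blk i ≤ blk j then B (blk j - blk i) (pos i) (pos j) else 0) -
        (if i = j then 1 else 0) := by
    intro i j
    rw [← entry_one i j, ← entry_ofEntries _ (finite_support_toeplitz B) i j]
    rfl
  intro i
  obtain ⟨k, c, rfl⟩ : ∃ k c, i = unblk k c := ⟨_, _, (unblk_blk_pos i).symm⟩
  constructor
  · have hne : unblk k c ≠ unblk k c + 1 := (PNat.lt_add_right _ _).ne
    rw [hJ, if_neg hne]
    fin_cases c
    · have : unblk k 0 + 1 = unblk k 1 := rfl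
      simp [this, B]
    · have : unblk k 1 + 1 = unblk (k + 1) 0 := rfl
      simp [this, B]
  · intro j hj
    obtain ⟨l, a, rfl⟩ : ∃ k c, j = unblk k c := ⟨_, _, (unblk_blk_pos j).symm⟩
    rw [hJ]
    rw [PNat.lt_add_one_iff] at hj
    rcases hj.eq_or_lt with h | h
    · rw [h]
      fin_cases c <;> simp [B]
    · rw [if_neg h.ne']
      rw [← PNat.coe_lt_coe] at h
      simp only [unblk, Nat.succPNat_coe] at h
      simp only [blk_unblk, pos_unblk]
      have := c.2
      have := a.2
      split_ifs with hkl
      · obtain rfl : k = l := by omega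
        obtain rfl : c = 1 := by ext; simp; omega
        obtain rfl : a = 0 := by ext; simp; omega
        simp [B]
      · simp

theorem iterate_add_one (n : ℕ) (i : ℕ+) :
    ((fun i : ℕ+ => i + 1)^[n] i : ℕ) = i + n := by
  induction n with
  | zero => rfl
  | succ n ih => rw [Function.iterate_succ_apply', PNat.add_coe, ih, PNat.one_coe, add_assoc]

theorem iterate_natPred (i : ℕ+) : (fun i : ℕ+ => i + 1)^[i.natPred] 1 = i := by
  apply PNat.eq
  rw [iterate_add_one, PNat.one_coe, PNat.one_add_natPred]

theorem upper_P (i j : ℕ+) (hj : j < i) : entry ((Jt - 1) ^ i.natPred) 1 j = 0 := by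
  refine ((leads_Jt_sub_one.pow (fun a b h => by gcongr) i.natPred) 1).2 j ?_
  rwa [iterate_natPred]

/-- The matrix `P`: the `i`-th row of `P` is the first row of `(J̃ - 1) ^ (i - 1)`. -/
noncomputable def P : 𝒜 :=
  ofEntries (fun i j => entry ((Jt - 1) ^ i.natPred) 1 j) (finite_support_of_upper upper_P)

theorem isUnit_P : IsUnit P := by
  refine Leads.isUnit fun i => ⟨?_, fun j hj => ?_⟩
  · have := ((leads_Jt_sub_one.pow (fun a b h => show a + 1 < b + 1 by gcongr) i.natPred) 1).1
    rw [iterate_natPred] at this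
    rw [P, entry_ofEntries]
    exact this
  · rw [P, entry_ofEntries]
    exact upper_P i j hj

/-! ### The representation -/

/-- The positive integer `2 ^ (l - 1) * d`. -/
def chain (d l : ℕ+) : ℕ+ := 2 ^ l.natPred * d

/-- The homomorphism `ψ`: the `(2 ^ (k - 1) * d, 2 ^ (l - 1) * d)` entry of `ψ(A)`, for `d` odd, is
the `(k, l)` entry of `A`, and all other entries of `ψ(A)` are zero. -/
noncomputable def psiFun (A : 𝒜) : 𝒜 :=
  Finsupp.linearCombination ℂ fun j =>
    Finsupp.mapDomain (chain (oddPart j)) (A (e (twoVal j).succPNat))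

theorem psiFun_e (A : 𝒜) (j : ℕ+) :
    psiFun A (e j) = Finsupp.mapDomain (chain (oddPart j)) (A (e (twoVal j).succPNat)) := by
  simp [psiFun]

theorem psiFun_mapDomain (A : 𝒜) (d : ℕ+) (hd : Odd (d : ℕ)) (f : E) :
    psiFun A (Finsupp.mapDomain (chain d) f) = Finsupp.mapDomain (chain d) (A f) := by
  have h : psiFun A ∘ₗ Finsupp.lmapDomain ℂ ℂ (chain d) = Finsupp.lmapDomain ℂ ℂ (chain d) ∘ₗ A := by
    refine Finsupp.lhom_ext' fun l => LinearMap.ext_ring ?_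
    simp only [LinearMap.comp_apply, Finsupp.lsingle_apply, Finsupp.lmapDomain_apply,
      Finsupp.mapDomain_single]
    rw [psiFun_e, chain, oddPart_two_pow_mul _ _ hd, twoVal_two_pow_mul _ _ hd,
      PNat.succPNat_natPred]
  exact LinearMap.congr_fun h f

/-- The homomorphism `ψ` on the ring of column-finite matrices. -/
noncomputable def psi : 𝒜 →* 𝒜 where
  toFun := psiFun
  map_one' := by
    refine Finsupp.lhom_ext' fun j => LinearMap.ext_ring ?_
    simp only [LinearMap.comp_apply, Finsupp.lsingle_apply]
    rw [psiFun_e, Module.End.one_apply, Finsupp.mapDomain_single, chain, Nat.natPred_succPNat,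
      two_pow_mul_oddPart, Module.End.one_apply]
  map_mul' A B := by
    refine Finsupp.lhom_ext' fun j => LinearMap.ext_ring ?_
    simp only [LinearMap.comp_apply, Finsupp.lsingle_apply, Module.End.mul_apply]
    rw [psiFun_e, psiFun_e, psiFun_mapDomain _ _ (odd_oddPart j), Module.End.mul_apply]

/-- The representation `τ(Y) = P τ₁(Y) P⁻¹` of `SL(2, ℤ)`. -/
noncomputable def tau : SL(2, ℤ) →* 𝒜ˣ :=
  (MulAut.conj isUnit_P.unit).toMonoidHom.comp tau₁

/-- The representation `ρ(Y) = Z⁻¹ ψ(τ(Y)) Z` of `SL(2, ℤ)`. -/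
noncomputable def rho : SL(2, ℤ) →* 𝒜ˣ :=
  (MulAut.conj isUnit_Z.unit⁻¹).toMonoidHom.comp ((Units.map psi).comp tau)

theorem entry_mul_congr {A A' : 𝒜} {i i' : ℕ+} (h : ∀ m, entry A i m = entry A' i' m) (C : 𝒜)
    (j : ℕ+) : entry (A * C) i j = entry (A' * C) i' j := by
  have hs : ∀ m, entry C m j ≠ 0 → m ∈ (C (e j)).support := fun m hm => by simpa [entry] using hm
  rw [entry_mul A C i j _ hs, entry_mul A' C i' j _ hs]
  exact Finset.sum_congr rfl fun m _ => by rw [h]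

theorem chain_injective (d : ℕ+) : Function.Injective (chain d) := by
  intro k l h
  have h1 : (2 : ℕ+) ^ k.natPred = 2 ^ l.natPred := mul_right_cancel h
  have h2 := congrArg PNat.val h1
  simp only [PNat.pow_coe, PNat.val_ofNat] at h2
  have h3 := Nat.pow_right_injective le_rfl h2
  rw [← PNat.succPNat_natPred k, h3, PNat.succPNat_natPred]

theorem entry_psi (A : 𝒜) (i j : ℕ+) : entry (psi A) i j =
    if oddPart i = oddPart j then entry A (twoVal i).succPNat (twoVal j).succPNat else 0 := by
  change psiFun A (e j) i = _
  rw [psiFun_e]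
  split_ifs with h
  · have hi : i = chain (oddPart j) (twoVal i).succPNat := by
      rw [chain, Nat.natPred_succPNat, ← h, two_pow_mul_oddPart]
    conv_lhs => rw [hi]
    rw [Finsupp.mapDomain_apply (chain_injective _)]
    rfl
  · rw [Finsupp.mapDomain_of_notMem_range]
    rintro ⟨l, rfl⟩
    exact h (oddPart_two_pow_mul _ _ (odd_oddPart j))

/-- The standard unipotent element acts as the divisor matrix. -/
theorem rho_T : ((rho ModularGroup.T : 𝒜ˣ) : 𝒜) = D := by
  set Pu := isUnit_P.unit with hPu
  set Zu := isUnit_Z.unit with hZu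
  have hP : (Pu : 𝒜) = P := rfl
  have hZ : (Zu : 𝒜) = Z := rfl
  have hT : tau₁ ModularGroup.T = JtUnit := existsUnique_tau₁.choose_spec.1.2
  have h1 : ((rho ModularGroup.T : 𝒜ˣ) : 𝒜) =
      ((Zu⁻¹ : 𝒜ˣ) : 𝒜) * psi (P * Jt * (Pu⁻¹ : 𝒜ˣ)) * Z := by
    simp [rho, tau, hT, coe_JtUnit, ← hPu, ← hZu, hP, hZ]
  rw [h1, mul_assoc, ← hZ, Units.inv_mul_eq_iff_eq_mul, hZ]
  have hN : ∀ i j, entry (P * Jt * (Pu⁻¹ : 𝒜ˣ)) i j =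
      (if i = j then 1 else 0) + if i + 1 = j then 1 else 0 := by
    intro i j
    have : P * Jt * (Pu⁻¹ : 𝒜ˣ) = 1 + P * (Jt - 1) * (Pu⁻¹ : 𝒜ˣ) := by
      have h : P * (Jt - 1) = P * Jt - P := (mul_sub_one P Jt :)
      have h' : (P * Jt - P) * (Pu⁻¹ : 𝒜ˣ) = P * Jt * (Pu⁻¹ : 𝒜ˣ) - P * (Pu⁻¹ : 𝒜ˣ) :=
        (sub_mul (P * Jt) P _ :)
      rw [h, h', ← hP, Units.mul_inv]
      exact (add_sub_cancel (1 : 𝒜) (↑Pu * Jt * ↑Pu⁻¹) :).symm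
    rw [this, show entry (1 + P * (Jt - 1) * (Pu⁻¹ : 𝒜ˣ)) i j =
      entry 1 i j + entry (P * (Jt - 1) * (Pu⁻¹ : 𝒜ˣ)) i j from rfl, entry_one,
      entry_mul_congr (A' := P) (i' := i + 1), ← hP, Units.mul_inv, entry_one]
    intro m
    rw [entry_mul_congr (A' := (Jt - 1) ^ i.natPred) (i' := 1), ← pow_succ]
    · have hi : (i + 1).natPred = i.natPred + 1 := by
        have := i.pos
        simp only [PNat.natPred, PNat.add_coe, PNat.one_coe]
        omega
      rw [P, entry_ofEntries, hi]
    · intro m; rw [P, entry_ofEntries]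
  have hJ : ∀ i j, entry (psi (P * Jt * (Pu⁻¹ : 𝒜ˣ))) i j =
      (if i = j then 1 else 0) + if 2 * i = j then 1 else 0 := by
    intro i j
    have hi := two_pow_mul_oddPart i
    have hj := two_pow_mul_oddPart j
    rw [entry_psi, hN]
    have e1 : (i = j) ↔ oddPart i = oddPart j ∧ (twoVal i).succPNat = (twoVal j).succPNat := by
      constructor
      · rintro rfl; simp
      · rintro ⟨h, h'⟩; rw [← hi, ← hj, h, Nat.succPNat_injective h']
    have h2i : 2 * i = 2 ^ (twoVal i + 1) * oddPart i := by
      conv_lhs => rw [← hi]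
      rw [pow_succ', mul_assoc]
    have e2 : (2 * i = j) ↔
        oddPart i = oddPart j ∧ (twoVal i).succPNat + 1 = (twoVal j).succPNat := by
      constructor
      · rintro rfl
        rw [h2i, oddPart_two_pow_mul _ _ (odd_oddPart i), twoVal_two_pow_mul _ _ (odd_oddPart i)]
        exact ⟨rfl, rfl⟩
      · rintro ⟨h, h'⟩
        have : twoVal j = twoVal i + 1 := (Nat.succPNat_injective h').symm
        rw [h2i, ← this, h, hj]
    simp only [e1, e2]
    split_ifs <;> simp_all
  refine entry_ext fun i j => ?_
  have hs : ∀ m, entry Z m j ≠ 0 → m ∈ insert (2 * i) (insert i (Z (e j)).support) :=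
    fun m hm => by simp only [Finset.mem_insert]; right; right; simpa [entry] using hm
  have hne : i ≠ 2 * i := by
    intro h
    have := congrArg PNat.val h
    simp only [PNat.mul_coe, PNat.val_ofNat] at this
    have := i.pos
    omega
  rw [entry_mul _ _ _ _ _ hs]
  simp only [hJ, add_mul, ite_mul, one_mul, zero_mul, Finset.sum_add_distrib, Finset.sum_ite_eq,
    Finset.mem_insert, true_or, or_true, if_true]
  have : Z * D = Z + Z * (D - 1) := by
    have h : Z * (D - 1) = Z * D - Z := (mul_sub_one Z D :)
    rw [h]
    exact (add_sub_cancel Z (Z * D) :).symm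
  rw [this, show entry (Z + Z * (D - 1)) i j = entry Z i j + entry (Z * (D - 1)) i j from rfl]
  congr 1
  rw [entry_mul_congr (A' := (D - 1) ^ twoVal i) (i' := oddPart i), ← pow_succ]
  · have h2i : 2 * i = 2 ^ (twoVal i + 1) * oddPart i := by
      conv_lhs => rw [← two_pow_mul_oddPart i]
      rw [pow_succ', mul_assoc]
    rw [Z, entry_ofEntries, h2i, oddPart_two_pow_mul _ _ (odd_oddPart i),
      twoVal_two_pow_mul _ _ (odd_oddPart i)]
  · intro m; rw [Z, entry_ofEntries]

/-! ### Dirichlet series -/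

/-- The coefficient sequence of the Dirichlet series `1`. -/
noncomputable def oneSeq : ℕ+ → ℂ := Pi.single 1 1

/-- The coefficient sequence of the Dirichlet series `φ = 1.ρ(-S)`. -/
noncomputable def phiCoeff : ℕ+ → ℂ := act oneSeq (rho (-ModularGroup.S) : 𝒜ˣ)

/-- The sum of the first `N` terms of the Dirichlet series `∑ f(n) n⁻ˢ`. -/
noncomputable def partialSum (f : ℕ+ → ℂ) (s : ℂ) (N : ℕ) : ℂ :=
  ∑ n ∈ Finset.range N, f n.succPNat * ((n + 1 : ℕ) : ℂ) ^ (-s)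

/-- The abscissa of (conditional) convergence: the infimum of the `σ` such that the series
`∑ f(n) n⁻ˢ` converges whenever `σ < re s`. -/
noncomputable def convAbscissa (f : ℕ+ → ℂ) : EReal :=
  sInf {σ | ∀ s : ℂ, σ < (s.re : EReal) → ∃ w, Tendsto (partialSum f s) atTop (𝓝 w)}

/-- The sum of the (possibly only conditionally convergent) Dirichlet series `∑ f(n) n⁻ˢ`. -/
noncomputable def dirichletSum (f : ℕ+ → ℂ) (s : ℂ) : ℂ := limUnder atTop (partialSum f s)

end DivisorMatrix

/-!
Write `t` for the variable of `ℂ⟦t⟧` and `g` for the power series with `g ^ 2 + g = t`. Every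
`ρ(Y)` has the form `Z⁻¹ ψ(P M̃ P⁻¹) Z`, where `M̃` is the block Toeplitz matrix of a `2 × 2` matrix
`M` over `ℂ⟦t⟧`, and `M ↦ Z⁻¹ ψ(P M̃ P⁻¹) Z` is a ring homomorphism, `transport`. It sends
`J = (1, 1 + g; g, 1 + t)` to the divisor matrix `D`, and since the first rows of `P` and `Z` are
those of the identity, the first row of its value depends only on the first row of `M`. The matrix
`-S = (0, 1; -1, 0)` may therefore be replaced by `W = (1 + g)⁻¹ (J - 1)`, which has the same first
row `(0, 1)` and, in contrast to `-S`, commutes with `J`.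

The Cayley–Hamilton relation `(J - 1) ^ 2 = t J` gives `W ^ 2 (J - 1) + W J = (J - 1) J`. The first
row of `transport W` is a formal series in the first rows of the powers of `D - 1`, that is, in the
powers of `ζ - 1` under Dirichlet multiplication. As `transport W` commutes with `D - 1`, it acts
on its own first row as Dirichlet multiplication by that row (`firstRow_transport_mul_self`). The
matrix relation thus becomes the formal identity `(ζ - 1) φ ^ 2 + ζ φ = ζ (ζ - 1)`
(`phi_quadratic`).

Solved for `φ`, this identity reads `φ = (ζ - 1) + (ζ - 1) ^ 2 - (ζ - 1) φ - (ζ - 1) φ ^ 2`, in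
which the coefficients on the right involve only earlier coefficients of `φ`. Because
`∑ n ^ (-3) ≤ 1 / 4` over `n ≥ 2`, induction bounds every partial sum of `∑ |a n| n ^ (-3)` by
`1 / 4 + 1 / 16 + 1 / 8 + 1 / 16 = 1 / 2` (`sum_range_norm_phi_le`). So `φ` converges absolutely for
`re s ≥ 3`, and the identity holds there between functions. Finally, Abel summation shows that a
Dirichlet series is holomorphic to the right of any real point where it converges
(`differentiableOn_dirichletSum`), and the identity theorem carries the equation to the half-plane
`re s > max 1 σ_c`.
-/

namespace DivisorMatrix

/-! ### From matrices over power series to column-finite matrices -/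

theorem entry_add (A B : 𝒜) (i j : ℕ+) : entry (A + B) i j = entry A i j + entry B i j := rfl

theorem entry_zero (i j : ℕ+) : entry 0 i j = 0 := rfl

theorem psi_add (A B : 𝒜) : psi (A + B) = psi A + psi B :=
  entry_ext fun i j => by
    simp only [entry_add, entry_psi]
    split_ifs <;> simp

theorem psi_zero : psi 0 = 0 :=
  entry_ext fun i j => by simp [entry_psi, entry_zero]

theorem toeplitzHom_add (M N : Matrix (Fin 2) (Fin 2) (PowerSeries ℂ)) :
    toeplitzHom (M + N) = toeplitzHom M + toeplitzHom N :=
  entry_ext fun i j => by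
    simp only [entry_add, toeplitzHom_apply, toeplitz, entry_ofEntries]
    split_ifs <;> simp

theorem toeplitzHom_zero : toeplitzHom 0 = 0 :=
  entry_ext fun i j => by simp [toeplitzHom_apply, toeplitz, entry_zero]

/-- The ring homomorphism `M ↦ Z⁻¹ ψ(P M̃ P⁻¹) Z`, where `M̃` is the block Toeplitz matrix of `M`.
The representation `ρ` factors through it. -/
noncomputable def transport : Matrix (Fin 2) (Fin 2) (PowerSeries ℂ) →+* 𝒜 where
  toFun M := ((isUnit_Z.unit⁻¹ : 𝒜ˣ) : 𝒜) *
    psi ((isUnit_P.unit : 𝒜) * toeplitzHom M * ((isUnit_P.unit⁻¹ : 𝒜ˣ) : 𝒜)) *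
      (isUnit_Z.unit : 𝒜)
  map_one' := by rw [map_one, mul_one, Units.mul_inv, map_one, mul_one, Units.inv_mul]
  map_mul' M N := by
    have h : (isUnit_P.unit : 𝒜) * toeplitzHom (M * N) * ((isUnit_P.unit⁻¹ : 𝒜ˣ) : 𝒜) =
        ((isUnit_P.unit : 𝒜) * toeplitzHom M * ((isUnit_P.unit⁻¹ : 𝒜ˣ) : 𝒜)) *
        ((isUnit_P.unit : 𝒜) * toeplitzHom N * ((isUnit_P.unit⁻¹ : 𝒜ˣ) : 𝒜)) := by
      simp only [map_mul, mul_assoc, Units.inv_mul_cancel_left]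
    rw [h, map_mul]
    simp only [mul_assoc, Units.mul_inv_cancel_left]
  map_zero' := by
    rw [toeplitzHom_zero]
    have h : (isUnit_P.unit : 𝒜) * 0 * ((isUnit_P.unit⁻¹ : 𝒜ˣ) : 𝒜) = 0 := by
      rw [mul_zero, zero_mul]
    rw [h, psi_zero, mul_zero, zero_mul]
  map_add' M N := by
    rw [toeplitzHom_add, mul_add, add_mul, psi_add, mul_add, add_mul]

theorem transport_apply (M : Matrix (Fin 2) (Fin 2) (PowerSeries ℂ)) :
    transport M = ((isUnit_Z.unit⁻¹ : 𝒜ˣ) : 𝒜) *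
      psi ((isUnit_P.unit : 𝒜) * toeplitzHom M * ((isUnit_P.unit⁻¹ : 𝒜ˣ) : 𝒜)) *
        (isUnit_Z.unit : 𝒜) := rfl

theorem rho_eq_transport {Y : SL(2, ℤ)} {M : Matrix (Fin 2) (Fin 2) (PowerSeries ℂ)}
    (h : (tau₁ Y : 𝒜) = toeplitzHom M) : (rho Y : 𝒜) = transport M := by
  rw [transport_apply, ← h]
  simp [rho, tau]

theorem transport_T : transport !![1, 1 + g; g, 1 + PowerSeries.X] = D := by
  rw [← rho_T, rho_eq_transport]
  rw [← Jt_eq, ← coe_JtUnit, show tau₁ ModularGroup.T = JtUnit from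
    existsUnique_tau₁.choose_spec.1.2]

theorem rho_neg_S : (rho (-ModularGroup.S) : 𝒜) = transport !![0, 1; -1, 0] := by
  refine rho_eq_transport ?_
  have h : (-ModularGroup.S : SL(2, ℤ)) = ModularGroup.S ^ 3 := by decide
  have hS : tau₁ ModularGroup.S = StUnit := existsUnique_tau₁.choose_spec.1.1
  rw [h, map_pow, hS, Units.val_pow_eq_pow_val, coe_StUnit, St_eq, ← map_pow]
  congr 1
  simp [pow_succ]

/-! ### First rows -/

theorem entry_P_one (m : ℕ+) : entry P 1 m = entry 1 1 m := by
  rw [P, entry_ofEntries]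
  rfl

theorem twoVal_one : twoVal 1 = 0 := by simp [twoVal]

theorem oddPart_one : oddPart 1 = 1 := by
  have h := two_pow_mul_oddPart 1
  rwa [twoVal_one, pow_zero, one_mul] at h

theorem entry_Z_one (m : ℕ+) : entry Z 1 m = entry 1 1 m := by
  rw [Z, entry_ofEntries, twoVal_one, oddPart_one, pow_zero]

theorem entry_inv_one {u : 𝒜ˣ} (h : ∀ m, entry (u : 𝒜) 1 m = entry 1 1 m) (m : ℕ+) :
    entry ((u⁻¹ : 𝒜ˣ) : 𝒜) 1 m = entry 1 1 m := by
  have h1 := entry_mul_congr h ((u⁻¹ : 𝒜ˣ) : 𝒜) m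
  rw [Units.mul_inv, one_mul] at h1
  exact h1.symm

theorem entry_transport_one (M : Matrix (Fin 2) (Fin 2) (PowerSeries ℂ)) (j : ℕ+) :
    entry (transport M) 1 j =
      entry (psi (toeplitzHom M * ((isUnit_P.unit⁻¹ : 𝒜ˣ) : 𝒜)) * Z) 1 j := by
  rw [transport_apply, mul_assoc, entry_mul_congr (A' := 1) (i' := 1)
    (entry_inv_one fun m => entry_Z_one m), one_mul]
  refine entry_mul_congr (fun m => ?_) Z j
  rw [entry_psi, entry_psi, twoVal_one, mul_assoc]
  congr 1
  change entry (P * (toeplitzHom M * ((isUnit_P.unit⁻¹ : 𝒜ˣ) : 𝒜))) 1 _ = _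
  rw [entry_mul_congr entry_P_one, one_mul]
  rfl

/-- The first row of `transport M` depends on the first row of `M` only. -/
theorem entry_transport_one_congr {M N : Matrix (Fin 2) (Fin 2) (PowerSeries ℂ)}
    (h : ∀ c, M 0 c = N 0 c) (j : ℕ+) : entry (transport M) 1 j = entry (transport N) 1 j := by
  rw [entry_transport_one, entry_transport_one]
  refine entry_mul_congr (fun m => ?_) Z j
  rw [entry_psi, entry_psi, twoVal_one]
  congr 1
  refine entry_mul_congr (fun m => ?_) _ _
  have hp : pos (Nat.succPNat 0) = 0 := rfl
  simp only [toeplitzHom_apply, toeplitz, entry_ofEntries, hp, Matrix.map_apply, h]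

/-- The first row of `transport M` is a formal combination of the first rows of the powers of
`D - 1`. -/
theorem exists_entry_transport_one (M : Matrix (Fin 2) (Fin 2) (PowerSeries ℂ)) :
    ∃ c : ℕ → ℂ, ∀ (n : ℕ+) (K : ℕ), (n : ℕ) ≤ K → entry (transport M) 1 n =
      ∑ k ∈ Finset.range K, c k * entry ((D - 1) ^ k) 1 n := by
  refine ⟨fun k => entry (toeplitzHom M * ((isUnit_P.unit⁻¹ : 𝒜ˣ) : 𝒜)) 1 k.succPNat,
    fun n K hK => ?_⟩
  have hinj : Function.Injective fun k : ℕ => (2 : ℕ+) ^ k := fun a b h => by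
    have := congrArg PNat.val h
    simpa using this
  rw [entry_transport_one, entry_mul _ _ _ _
    ((Finset.range K).map ⟨_, hinj⟩ ∪ (Z (e n)).support) fun m hm => Finset.mem_union_right _
      (by simpa [entry] using hm),
    ← Finset.sum_subset Finset.subset_union_left, Finset.sum_map]
  · refine Finset.sum_congr rfl fun k _ => ?_
    have h1 : twoVal (2 ^ k) = k := by simpa using twoVal_two_pow_mul k 1 (by simp)
    have h2 : oddPart (2 ^ k) = 1 := by simpa using oddPart_two_pow_mul k 1 (by simp)
    simp only [Function.Embedding.coeFn_mk]
    rw [entry_psi, twoVal_one, oddPart_one, h1, h2, if_pos rfl, Z, entry_ofEntries, h1, h2]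
    rfl
  · intro m _ hm
    rw [entry_psi, oddPart_one]
    split_ifs with h
    · have hm2 : 2 ^ twoVal m = m := by
        conv_rhs => rw [← two_pow_mul_oddPart m, ← h, mul_one]
      have hlt : n < m := by
        have hK' : K ≤ twoVal m := by
          by_contra hlt
          exact hm (Finset.mem_map.2 ⟨twoVal m, Finset.mem_range.2 (not_le.1 hlt), hm2⟩)
        rw [← PNat.coe_lt_coe]
        calc (n : ℕ) ≤ twoVal m := hK.trans hK'
          _ < 2 ^ twoVal m := Nat.lt_two_pow_self
          _ = m := by conv_rhs => rw [← hm2]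
                      simp
      rw [Z, entry_ofEntries, upper_Z m n hlt, mul_zero]
    · rw [zero_mul]

/-! ### First rows as arithmetic functions -/

/-- The first row of a column-finite matrix, as an arithmetic function. -/
noncomputable def firstRow (A : 𝒜) : ArithmeticFunction ℂ :=
  ⟨fun n => if h : 0 < n then entry A 1 ⟨n, h⟩ else 0, by simp⟩

theorem firstRow_coe (A : 𝒜) (n : ℕ+) : firstRow A n = entry A 1 n := by
  change (if h : 0 < (n : ℕ) then entry A 1 ⟨n, h⟩ else 0) = _
  rw [dif_pos n.pos]
  rfl

theorem arithmeticFunction_ext {f f' : ArithmeticFunction ℂ} (h : ∀ n : ℕ+, f n = f' n) :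
    f = f' := by
  ext n
  rcases n.eq_zero_or_pos with rfl | hn
  · simp
  · exact h ⟨n, hn⟩

theorem firstRow_add (A B : 𝒜) : firstRow (A + B) = firstRow A + firstRow B :=
  arithmeticFunction_ext fun n => by
    simp only [ArithmeticFunction.add_apply, firstRow_coe, entry_add]

theorem firstRow_sub (A B : 𝒜) : firstRow (A - B) = firstRow A - firstRow B := by
  rw [eq_sub_iff_add_eq, ← firstRow_add]
  congr 1
  exact (sub_add_cancel A B :)

theorem firstRow_one : firstRow 1 = 1 :=
  arithmeticFunction_ext fun n => by
    simp only [firstRow_coe, entry_one, ArithmeticFunction.one_apply, eq_comm (a := (1 : ℕ+)),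
      PNat.coe_eq_one_iff]

/-- Right multiplication by the divisor matrix is Dirichlet multiplication by `ζ`. -/
theorem firstRow_mul_D (A : 𝒜) :
    firstRow (A * D) = firstRow A * (ArithmeticFunction.zeta : ArithmeticFunction ℂ) :=
  arithmeticFunction_ext fun n => by
    have hinj : Function.Injective fun d : (n : ℕ).divisors =>
        (⟨d.1, Nat.pos_of_mem_divisors d.2⟩ : ℕ+) := fun a b h =>
      Subtype.ext (congrArg PNat.val h)
    rw [firstRow_coe, ArithmeticFunction.coe_mul_zeta_apply, entry_mul A D 1 n
      ((n : ℕ).divisors.attach.map ⟨_, hinj⟩), Finset.sum_map,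
      ← Finset.sum_attach (n : ℕ).divisors]
    · refine Finset.sum_congr rfl fun d _ => ?_
      have hd := Nat.dvd_of_mem_divisors d.2
      refine Eq.trans ?_ (firstRow_coe A ⟨d.1, Nat.pos_of_mem_divisors d.2⟩).symm
      rw [D, entry_ofEntries]
      exact (congrArg _ (if_pos hd)).trans (mul_one _)
    · intro m hm
      simp only [D, entry_ofEntries, ne_eq, ite_eq_right_iff, one_ne_zero, imp_false,
        not_not] at hm
      exact Finset.mem_map.2 ⟨⟨m, Nat.mem_divisors.2 ⟨hm, n.ne_zero⟩⟩, Finset.mem_attach _ _, rfl⟩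

theorem firstRow_mul_D_sub_one_pow (A : 𝒜) (k : ℕ) :
    firstRow (A * (D - 1) ^ k) =
      firstRow A * ((ArithmeticFunction.zeta : ArithmeticFunction ℂ) - 1) ^ k := by
  induction k with
  | zero => simp
  | succ k ih =>
    have h : A * (D - 1) ^ (k + 1) = A * (D - 1) ^ k * D - A * (D - 1) ^ k := by
      rw [pow_succ, ← mul_assoc]
      exact (mul_sub_one (A * (D - 1) ^ k) D :)
    rw [h, firstRow_sub, firstRow_mul_D, ih]
    ring

/-- If `transport M` commutes with the divisor matrix, then it acts on its own first row as
Dirichlet multiplication by that row. -/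
theorem firstRow_transport_mul_self {M : Matrix (Fin 2) (Fin 2) (PowerSeries ℂ)}
    (hM : Commute (transport M) (D - 1)) :
    firstRow (transport M * transport M) = firstRow (transport M) * firstRow (transport M) := by
  obtain ⟨c, hc⟩ := exists_entry_transport_one M
  set W := transport M with hW
  refine arithmeticFunction_ext fun n => ?_
  set s := (W (e n)).support with hs
  have hs' : ∀ m, entry W m n ≠ 0 → m ∈ s := fun m hm => by simpa [entry, hs] using hm
  -- `K` is large enough for the expansion of every entry of the first row that matters.
  obtain ⟨K, hKn, hKs⟩ : ∃ K : ℕ, (n : ℕ) ≤ K ∧ ∀ m ∈ s, (m : ℕ) ≤ K :=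
    ⟨n + ∑ m ∈ s, (m : ℕ), by omega, fun m hm => by
      have := Finset.single_le_sum (f := fun m : ℕ+ => (m : ℕ)) (fun _ _ => Nat.zero_le _) hm
      omega⟩
  have hrow : ∀ d : ℕ, d ≤ K → firstRow W d =
      ∑ k ∈ Finset.range K,
        c k * (((ArithmeticFunction.zeta : ArithmeticFunction ℂ) - 1) ^ k) d := by
    intro d hd
    rcases d.eq_zero_or_pos with rfl | h0
    · simp
    · lift d to ℕ+ using h0
      rw [firstRow_coe, hc d K hd]
      refine Finset.sum_congr rfl fun k _ => ?_
      have := firstRow_mul_D_sub_one_pow 1 k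
      rw [one_mul, firstRow_one, one_mul] at this
      rw [← this, firstRow_coe]
  have hcomm : ∀ k : ℕ, ∑ m ∈ s, entry ((D - 1) ^ k) 1 m * entry W m n =
      (firstRow W * ((ArithmeticFunction.zeta : ArithmeticFunction ℂ) - 1) ^ k) n := fun k => by
    rw [← entry_mul _ _ _ _ s hs', ← firstRow_mul_D_sub_one_pow, (hM.pow_right k).eq,
      firstRow_coe]
  calc firstRow (W * W) n
      = ∑ m ∈ s, ∑ k ∈ Finset.range K, c k * (entry ((D - 1) ^ k) 1 m * entry W m n) := by
        rw [firstRow_coe, entry_mul W W 1 n s hs']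
        refine Finset.sum_congr rfl fun m hm => ?_
        rw [hc m K (hKs m hm), Finset.sum_mul]
        simp only [mul_assoc]
    _ = ∑ k ∈ Finset.range K,
          c k * (firstRow W * ((ArithmeticFunction.zeta : ArithmeticFunction ℂ) - 1) ^ k) n := by
        rw [Finset.sum_comm]
        simp only [← Finset.mul_sum, hcomm]
    _ = (firstRow W * firstRow W) n := by
        simp only [ArithmeticFunction.mul_apply, Finset.mul_sum]
        rw [Finset.sum_comm]
        refine Finset.sum_congr rfl fun p hp => ?_
        have hp2 : p.2 ≤ K :=
          (Nat.divisor_le (Nat.snd_mem_divisors_of_mem_antidiagonal hp)).trans hKn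
        rw [hrow p.2 hp2, Finset.mul_sum]
        exact Finset.sum_congr rfl fun k _ => by ring

/-! ### The quadratic equation for the coefficients -/

/-- The formal Dirichlet series `φ` as an arithmetic function. -/
noncomputable def phi : ArithmeticFunction ℂ := firstRow (rho (-ModularGroup.S) : 𝒜ˣ)

theorem phiCoeff_eq (n : ℕ+) : phiCoeff n = phi n := by
  rw [phi, firstRow_coe, phiCoeff, act, entry, oneSeq, Finsupp.sum, Finset.sum_eq_single 1]
  · simp
  · intro m _ hm
    simp [hm]
  · intro h
    simp [Finsupp.notMem_support_iff.1 h]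

section Quadratic

variable {R : Type*} [CommRing R]

/-- With `h = (1 + g)⁻¹`, the first matrix is `h` times the second. -/
theorem twoByTwo_commute {g h t : R} (hh : (1 + g) * h = 1) (ht : g ^ 2 + g = t) :
    !![0, 1; h * g, g] * !![0, 1 + g; g, t] = !![0, 1 + g; g, t] * !![0, 1; h * g, g] := by
  refine Matrix.ext (Fin.forall_fin_two.2 ⟨Fin.forall_fin_two.2 ⟨?_, ?_⟩,
    Fin.forall_fin_two.2 ⟨?_, ?_⟩⟩) <;>
    simp only [Matrix.mul_fin_two, Matrix.of_apply, Matrix.cons_val',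
      Matrix.cons_val_zero, Matrix.cons_val_one, Matrix.cons_val_fin_one, ← ht]
  · linear_combination (-g) * hh
  · ring
  · linear_combination (-g ^ 2) * hh
  · linear_combination g * hh

/-- Writing `N` for `J - 1` and `W = h N` with `h = (1 + g)⁻¹`, this is `W ^ 2 N + W J = N J`; it
follows from `N ^ 2 = t J` and `h t = g`. -/
theorem twoByTwo_quadratic {g h t : R} (hh : (1 + g) * h = 1) (ht : g ^ 2 + g = t) :
    !![0, 1; h * g, g] * !![0, 1; h * g, g] * !![0, 1 + g; g, t] +
        !![0, 1; h * g, g] * !![1, 1 + g; g, 1 + t] =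
      !![0, 1 + g; g, t] * !![1, 1 + g; g, 1 + t] := by
  refine Matrix.ext (Fin.forall_fin_two.2 ⟨Fin.forall_fin_two.2 ⟨?_, ?_⟩,
    Fin.forall_fin_two.2 ⟨?_, ?_⟩⟩) <;>
    simp only [Matrix.mul_fin_two, Matrix.add_apply, Matrix.of_apply, Matrix.cons_val',
    Matrix.cons_val_zero, Matrix.cons_val_one, Matrix.cons_val_fin_one, ← ht]
  · ring
  · linear_combination g * hh
  · linear_combination g * hh
  · linear_combination (2 * g ^ 2 + g) * hh

end Quadratic

/-- Formally, `(ζ - 1) φ ^ 2 + ζ φ = ζ (ζ - 1)`. The first row of `-S` is also the first row of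
`M = (1 + g)⁻¹ (J - 1)`, where `J` is the matrix over `ℂ⟦t⟧` that gives `J̃`; unlike `-S`, the
matrix `M` commutes with `J`, and `J ^ 2 = (2 + t) J - 1` yields the quadratic equation for `M`. -/
theorem phi_quadratic :
    phi * phi * ((ArithmeticFunction.zeta : ArithmeticFunction ℂ) - 1) +
        phi * (ArithmeticFunction.zeta : ArithmeticFunction ℂ) =
      ((ArithmeticFunction.zeta : ArithmeticFunction ℂ) - 1) *
        (ArithmeticFunction.zeta : ArithmeticFunction ℂ) := by
  obtain ⟨h, hh⟩ : ∃ h : PowerSeries ℂ, (1 + g) * h = 1 :=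
    ⟨(1 + g)⁻¹, PowerSeries.mul_inv_cancel _ (by
      rw [map_add, map_one, ← PowerSeries.coeff_zero_eq_constantCoeff_apply, g,
        PowerSeries.coeff_mk]
      simp)⟩
  obtain ⟨J, hJ⟩ : ∃ J : Matrix (Fin 2) (Fin 2) (PowerSeries ℂ),
    J = !![1, 1 + g; g, 1 + PowerSeries.X] := ⟨_, rfl⟩
  obtain ⟨M, hM⟩ : ∃ M : Matrix (Fin 2) (Fin 2) (PowerSeries ℂ), M = !![0, 1; h * g, g] :=
    ⟨_, rfl⟩
  have hJ1 : J - 1 = !![0, 1 + g; g, PowerSeries.X] := by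
    rw [hJ, Matrix.one_fin_two]
    ext1 i j
    fin_cases i <;> fin_cases j <;> simp
  have hcomm : M * (J - 1) = (J - 1) * M := by
    rw [hJ1, hM]
    exact twoByTwo_commute hh g_sq_add_g
  have hquad : M * M * (J - 1) + M * J = (J - 1) * J := by
    rw [hJ1, hJ, hM]
    exact twoByTwo_quadratic hh g_sq_add_g
  have hrow : firstRow (transport M) = phi := by
    refine arithmeticFunction_ext fun n => ?_
    rw [phi, rho_neg_S, firstRow_coe, firstRow_coe]
    refine entry_transport_one_congr (fun c => ?_) n
    fin_cases c <;> simp [hM]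
  have hD : transport J = D := by rw [hJ, transport_T]
  have hD1 : transport (J - 1) = D - 1 := by rw [map_sub, map_one, hD]
  have hc : Commute (transport M) (D - 1) := by
    rw [← hD1]
    exact Commute.map hcomm transport
  have hq := congrArg (fun M => firstRow (transport M)) hquad
  simp only [map_add, map_mul, hD1, hD, firstRow_add] at hq
  have h1 := firstRow_mul_D_sub_one_pow (transport M * transport M) 1
  rw [pow_one, pow_one, firstRow_transport_mul_self hc, hrow] at h1
  have h2 := firstRow_mul_D 1
  rw [one_mul, firstRow_one, one_mul] at h2
  rw [h1, firstRow_mul_D, firstRow_mul_D, firstRow_sub, firstRow_one, hrow, h2] at hq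
  exact hq

/-! ### Absolute convergence far to the right -/

/-- Weighted partial sums of a Dirichlet product are at most the product of the weighted partial
sums over any ranges that contain all pairs of divisors that matter. -/
theorem sum_range_mul_le_of {f f' : ArithmeticFunction ℝ} (hf : ∀ n, 0 ≤ f n) (hf' : ∀ n, 0 ≤ f' n)
    {w : ℕ → ℝ} (hw : ∀ n, 0 ≤ w n) (hmul : ∀ m n, w (m * n) = w m * w n) {K L N : ℕ}
    (h : ∀ d e, d * e ≠ 0 → d * e < N → f' e ≠ 0 → d < K ∧ e < L) :
    ∑ n ∈ Finset.range N, (f * f') n * w n ≤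
      (∑ n ∈ Finset.range K, f n * w n) * ∑ n ∈ Finset.range L, f' n * w n := by
  set F : ℕ × ℕ → ℝ := fun p => f p.1 * w p.1 * (f' p.2 * w p.2) with hF
  have hF0 : ∀ p, 0 ≤ F p := fun p =>
    mul_nonneg (mul_nonneg (hf _) (hw _)) (mul_nonneg (hf' _) (hw _))
  set s := Finset.range K ×ˢ Finset.range L with hs
  calc ∑ n ∈ Finset.range N, (f * f') n * w n
      ≤ ∑ n ∈ Finset.range N, ∑ p ∈ s with p.1 * p.2 = n, F p := by
        refine Finset.sum_le_sum fun n hn => ?_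
        have h1 : (f * f') n * w n = ∑ p ∈ n.divisorsAntidiagonal, F p := by
          rw [ArithmeticFunction.mul_apply, Finset.sum_mul]
          refine Finset.sum_congr rfl fun p hp => ?_
          rw [← (Nat.mem_divisorsAntidiagonal.1 hp).1, hmul, hF]
          ring
        rw [h1, ← Finset.sum_filter_ne_zero]
        refine Finset.sum_le_sum_of_subset_of_nonneg (fun p hp => ?_) fun p _ _ => hF0 p
        obtain ⟨hp1, hp2⟩ := Finset.mem_filter.1 hp
        obtain ⟨rfl, hp3⟩ := Nat.mem_divisorsAntidiagonal.1 hp1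
        have hp4 := h p.1 p.2 hp3 (Finset.mem_range.1 hn) fun h0 => hp2 (by simp [hF, h0])
        simp [hs, hp4.1, hp4.2]
    _ = ∑ p ∈ s with p.1 * p.2 ∈ Finset.range N, F p :=
        Finset.sum_fiberwise_eq_sum_filter _ _ _ _
    _ ≤ ∑ p ∈ s, F p :=
        Finset.sum_le_sum_of_subset_of_nonneg (Finset.filter_subset _ _) fun p _ _ => hF0 p
    _ = _ := by rw [hs, Finset.sum_product, Finset.sum_mul_sum]

/-- Weighted partial sums of a product with a factor that vanishes at `1`: the other factor
contributes only its terms of strictly smaller index. -/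
theorem sum_range_mul_le {f f' : ArithmeticFunction ℝ} (hf : ∀ n, 0 ≤ f n) (hf' : ∀ n, 0 ≤ f' n)
    (h1 : f' 1 = 0) {w : ℕ → ℝ} (hw : ∀ n, 0 ≤ w n) (hmul : ∀ m n, w (m * n) = w m * w n) (N : ℕ) :
    ∑ n ∈ Finset.range (N + 1), (f * f') n * w n ≤
      (∑ n ∈ Finset.range N, f n * w n) * ∑ n ∈ Finset.range (N + 1), f' n * w n := by
  refine sum_range_mul_le_of hf hf' hw hmul fun d e h0 hde he => ?_
  obtain ⟨hd, he0⟩ := Nat.mul_ne_zero_iff.1 h0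
  have he1 : e ≠ 1 := fun h => he (h ▸ h1)
  have h2 : d * 2 ≤ d * e := Nat.mul_le_mul_left d (by omega)
  have h3 : 1 * e ≤ d * e := Nat.mul_le_mul_right e (by omega)
  omega

theorem sum_range_sq_le {f : ArithmeticFunction ℝ} (hf : ∀ n, 0 ≤ f n)
    {w : ℕ → ℝ} (hw : ∀ n, 0 ≤ w n) (hmul : ∀ m n, w (m * n) = w m * w n) (N : ℕ) :
    ∑ n ∈ Finset.range N, (f * f) n * w n ≤ (∑ n ∈ Finset.range N, f n * w n) ^ 2 := by
  rw [pow_two]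
  refine sum_range_mul_le_of hf hf hw hmul fun d e h0 hde _ => ?_
  obtain ⟨hd, he0⟩ := Nat.mul_ne_zero_iff.1 h0
  exact ⟨(Nat.le_mul_of_pos_right d (by omega)).trans_lt hde,
    (Nat.le_mul_of_pos_left e (by omega)).trans_lt hde⟩

theorem zeta_sub_one_apply {R : Type*} [Ring R] (n : ℕ) :
    ((ArithmeticFunction.zeta : ArithmeticFunction R) - 1) n = if n ≤ 1 then 0 else 1 := by
  have h : ((ArithmeticFunction.zeta : ArithmeticFunction R) - 1) n + (1 : ArithmeticFunction R) n =
      (ArithmeticFunction.zeta : ArithmeticFunction R) n := by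
    rw [← ArithmeticFunction.add_apply, sub_add_cancel]
  rw [← eq_sub_iff_add_eq] at h
  rw [h, ArithmeticFunction.natCoe_apply, ArithmeticFunction.zeta_apply,
    ArithmeticFunction.one_apply]
  obtain rfl | rfl | hn : n = 0 ∨ n = 1 ∨ 1 < n := by omega
  · simp
  · simp
  · simp [show n ≠ 0 by omega, show n ≠ 1 by omega, show ¬ n ≤ 1 by omega]

theorem zeta_sub_one_nonneg (n : ℕ) :
    0 ≤ ((ArithmeticFunction.zeta : ArithmeticFunction ℝ) - 1) n := by
  rw [zeta_sub_one_apply]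
  split_ifs <;> norm_num

/-- `∑ n ^ (-3) ≤ 1 / 4` over `n ≥ 2`, by comparison with a telescoping sum. -/
theorem sum_range_zeta_sub_one_le (N : ℕ) : ∑ n ∈ Finset.range N,
    ((ArithmeticFunction.zeta : ArithmeticFunction ℝ) - 1) n * ((n : ℝ) ^ 3)⁻¹ ≤ 1 / 4 := by
  have key : ∀ N : ℕ, ∑ n ∈ Finset.range (N + 2),
      ((ArithmeticFunction.zeta : ArithmeticFunction ℝ) - 1) n * ((n : ℝ) ^ 3)⁻¹ ≤
        1 / 4 - 1 / (2 * (N + 1) * (N + 2)) := by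
    intro N
    induction N with
    | zero => norm_num [Finset.sum_range_succ, zeta_sub_one_apply]
    | succ N ih =>
      rw [Finset.sum_range_succ]
      have h1 : ((ArithmeticFunction.zeta : ArithmeticFunction ℝ) - 1) (N + 1 + 1) = 1 := by
        rw [zeta_sub_one_apply, if_neg (by omega)]
      -- `1 / m ^ 3 ≤ 1 / ((m - 1) m (m + 1))` with `m = N + 2`.
      have h2 : (((N : ℝ) + 2) ^ 3)⁻¹ ≤
          1 / (2 * ((N : ℝ) + 1) * (N + 2)) - 1 / (2 * (N + 2) * (N + 3)) := by
        have h3 : 1 / (2 * ((N : ℝ) + 1) * (N + 2)) - 1 / (2 * (N + 2) * (N + 3)) =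
            (((N : ℝ) + 1) * (N + 2) * (N + 3))⁻¹ := by
          field_simp
          ring
        rw [h3]
        refine inv_anti₀ (by positivity) ?_
        nlinarith [(Nat.cast_nonneg N : (0 : ℝ) ≤ N)]
      have h4 : ((N + 1 + 1 : ℕ) : ℝ) = N + 2 := by push_cast; ring
      have h5 : 1 / (2 * (((N + 1 : ℕ) : ℝ) + 1) * ((N + 1 : ℕ) + 2)) =
          1 / (2 * ((N : ℝ) + 2) * (N + 3)) := by
        push_cast
        ring
      rw [h1, one_mul, h4, h5]
      linarith
  refine (Finset.sum_le_sum_of_subset_of_nonneg (Finset.range_subset_range.2 (by omega : N ≤ N + 2))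
    fun n _ _ => mul_nonneg (zeta_sub_one_nonneg n) (by positivity)).trans ((key N).trans ?_)
  have : 0 ≤ 1 / (2 * ((N : ℝ) + 1) * (N + 2)) := by positivity
  linarith

theorem norm_mul_apply_le (f f' : ArithmeticFunction ℂ) {F F' : ArithmeticFunction ℝ}
    (h : ∀ n, ‖f n‖ ≤ F n) (h' : ∀ n, ‖f' n‖ ≤ F' n) (n : ℕ) : ‖(f * f') n‖ ≤ (F * F') n := by
  rw [ArithmeticFunction.mul_apply, ArithmeticFunction.mul_apply]
  refine (norm_sum_le _ _).trans (Finset.sum_le_sum fun p _ => ?_)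
  rw [norm_mul]
  exact mul_le_mul (h _) (h' _) (norm_nonneg _) ((norm_nonneg _).trans (h _))

/-- The bound propagates because `1 / 4 + 1 / 16 + (1 / 2) / 4 + (1 / 2) ^ 2 / 4 = 1 / 2`. -/
theorem sum_range_norm_phi_le (N : ℕ) :
    ∑ n ∈ Finset.range N, ‖phi n‖ * ((n : ℝ) ^ 3)⁻¹ ≤ 1 / 2 := by
  set z : ArithmeticFunction ℂ := (ArithmeticFunction.zeta : ArithmeticFunction ℂ) - 1 with hz
  set x : ArithmeticFunction ℝ := (ArithmeticFunction.zeta : ArithmeticFunction ℝ) - 1 with hx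
  set α : ArithmeticFunction ℝ := ⟨fun n => ‖phi n‖, by simp⟩ with hα
  have hα_apply : ∀ n, α n = ‖phi n‖ := fun _ => rfl
  have hα0 : ∀ n, 0 ≤ α n := fun n => norm_nonneg (phi n)
  have hx0 : ∀ n, 0 ≤ x n := zeta_sub_one_nonneg
  have hx1 : x 1 = 0 := by
    rw [hx, zeta_sub_one_apply, if_pos le_rfl]
  have hzx : ∀ n, ‖z n‖ ≤ x n := fun n => by
    rw [hz, hx, zeta_sub_one_apply, zeta_sub_one_apply]
    split_ifs <;> simp
  have hφ : phi = z + z * z - phi * z - phi * phi * z := by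
    linear_combination phi_quadratic
  have hle : ∀ n, ‖phi n‖ ≤ x n + (x * x) n + (α * x) n + (α * α * x) n := by
    intro n
    conv_lhs => rw [hφ]
    simp only [sub_eq_add_neg, ArithmeticFunction.add_apply]
    refine (norm_add_le _ _).trans (add_le_add ((norm_add_le _ _).trans (add_le_add
      ((norm_add_le _ _).trans (add_le_add (hzx n) ?_)) ((norm_neg _).trans_le ?_)))
      ((norm_neg _).trans_le ?_))
    · exact norm_mul_apply_le _ _ hzx hzx n
    · exact norm_mul_apply_le _ _ (fun n => (hα_apply n).ge) hzx n
    · exact norm_mul_apply_le _ _ (norm_mul_apply_le _ _ (fun n => (hα_apply n).ge)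
        fun n => (hα_apply n).ge) hzx n
  set w : ℕ → ℝ := fun n => ((n : ℝ) ^ 3)⁻¹ with hw
  have hw0 : ∀ n, 0 ≤ w n := fun n => by positivity
  have hmul : ∀ m n, w (m * n) = w m * w n := fun m n => by
    simp only [hw, Nat.cast_mul, mul_pow, mul_inv]
  have hαα : ∀ n, 0 ≤ (α * α) n := fun n => by
    rw [ArithmeticFunction.mul_apply]
    exact Finset.sum_nonneg fun p _ => mul_nonneg (hα0 _) (hα0 _)
  induction N with
  | zero => simp
  | succ N ih =>
    set X := ∑ n ∈ Finset.range (N + 1), x n * w n with hX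
    have hX0 : 0 ≤ X := Finset.sum_nonneg fun n _ => mul_nonneg (hx0 n) (hw0 n)
    have hX4 : X ≤ 1 / 4 := sum_range_zeta_sub_one_le (N + 1)
    have hA0 : 0 ≤ ∑ n ∈ Finset.range N, α n * w n :=
      Finset.sum_nonneg fun n _ => mul_nonneg (hα0 n) (hw0 n)
    have h1 : ∑ n ∈ Finset.range (N + 1), (x * x) n * w n ≤ 1 / 4 * (1 / 4) :=
      (sum_range_mul_le hx0 hx0 hx1 hw0 hmul N).trans
        (mul_le_mul (sum_range_zeta_sub_one_le N) hX4 hX0 (by norm_num))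
    have h2 : ∑ n ∈ Finset.range (N + 1), (α * x) n * w n ≤ 1 / 2 * (1 / 4) :=
      (sum_range_mul_le hα0 hx0 hx1 hw0 hmul N).trans (mul_le_mul ih hX4 hX0 (by norm_num))
    have h3 : ∑ n ∈ Finset.range (N + 1), (α * α * x) n * w n ≤ (1 / 2) ^ 2 * (1 / 4) :=
      (sum_range_mul_le hαα hx0 hx1 hw0 hmul N).trans
        (mul_le_mul ((sum_range_sq_le hα0 hw0 hmul N).trans (pow_le_pow_left₀ hA0 ih 2)) hX4 hX0
          (by norm_num))
    calc ∑ n ∈ Finset.range (N + 1), ‖phi n‖ * w n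
        ≤ ∑ n ∈ Finset.range (N + 1),
            (x n + (x * x) n + (α * x) n + (α * α * x) n) * w n :=
          Finset.sum_le_sum fun n _ => mul_le_mul_of_nonneg_right (hle n) (hw0 n)
      _ ≤ 1 / 2 := by
          simp only [add_mul, Finset.sum_add_distrib]
          linarith

theorem LSeriesSummable_phi {s : ℂ} (hs : 3 ≤ s.re) : LSeriesSummable (phi ·) s := by
  have h3 : LSeriesSummable (phi ·) 3 := by
    rw [LSeriesSummable, ← summable_norm_iff]
    refine summable_of_sum_range_le (c := 1 / 2) (fun _ => norm_nonneg _) fun N => ?_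
    refine le_trans (le_of_eq (Finset.sum_congr rfl fun n _ => ?_)) (sum_range_norm_phi_le N)
    rw [LSeries.norm_term_eq]
    split_ifs with h
    · simp [h]
    · simp [div_eq_mul_inv]
  exact h3.of_re_le_re (by simpa using hs)

theorem LSeries_phi_quadratic {s : ℂ} (hs : 3 ≤ s.re) :
    (riemannZeta s - 1) * LSeries (phi ·) s ^ 2 + riemannZeta s * LSeries (phi ·) s -
      riemannZeta s * (riemannZeta s - 1) = 0 := by
  set ζ' : ArithmeticFunction ℂ := (ArithmeticFunction.zeta : ArithmeticFunction ℂ) with hζ'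
  have hζ : LSeriesHasSum (ζ' ·) s (riemannZeta s) := by
    simpa [hζ'] using ArithmeticFunction.LSeriesHasSum_zeta (s := s) (by linarith)
  have hφ : LSeriesHasSum (phi ·) s (LSeries (phi ·) s) := (LSeriesSummable_phi hs).LSeriesHasSum
  have h : phi * phi * ζ' + phi * ζ' + ζ' = ζ' * ζ' + phi * phi := by
    linear_combination phi_quadratic
  have hφφ := ArithmeticFunction.LSeriesHasSum_mul hφ hφ
  have h1 := ((ArithmeticFunction.LSeriesHasSum_mul hφφ hζ).add
    (ArithmeticFunction.LSeriesHasSum_mul hφ hζ)).add hζ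
  have h2 := (ArithmeticFunction.LSeriesHasSum_mul hζ hζ).add hφφ
  have h3 : (fun n => (phi * phi * ζ') n) + (fun n => (phi * ζ') n) + (fun n => ζ' n) =
      (fun n => (ζ' * ζ') n) + fun n => (phi * phi) n := by
    funext n
    simpa using congrArg (fun f : ArithmeticFunction ℂ => f n) h
  rw [h3] at h1
  linear_combination HasSum.unique h1 h2

/-! ### Conditionally convergent Dirichlet series -/

theorem tendsto_partialSum_of_LSeriesSummable {f : ℕ+ → ℂ} {f' : ArithmeticFunction ℂ}
    (hf : ∀ n : ℕ+, f n = f' n) {s : ℂ} (hs : LSeriesSummable (f' ·) s) :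
    Tendsto (partialSum f s) atTop (𝓝 (LSeries (f' ·) s)) := by
  have h := (hasSum_nat_add_iff' 1).2 hs.hasSum
  simp only [Finset.range_one, Finset.sum_singleton, LSeries.term_zero, sub_zero] at h
  refine h.tendsto_sum_nat.congr fun N => Finset.sum_congr rfl fun n _ => ?_
  rw [hf, LSeries.term_of_ne_zero (Nat.succ_ne_zero n), Nat.succPNat_coe, Complex.cpow_neg]
  rfl

/-- Each term of the series obtained by Abel summation is small. -/
theorem norm_cpow_sub_cpow_le {z : ℂ} (hz : 0 < z.re) (n : ℕ) :
    ‖((n + 2 : ℕ) : ℂ) ^ (-z) - ((n + 1 : ℕ) : ℂ) ^ (-z)‖ ≤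
      ‖z‖ * ((n + 1 : ℕ) : ℝ) ^ (-z.re - 1) := by
  have hderiv : ∀ x ∈ Set.Icc ((n + 1 : ℕ) : ℝ) ((n + 2 : ℕ) : ℝ),
      HasDerivWithinAt (fun x : ℝ => (x : ℂ) ^ (-z)) (-z * (x : ℂ) ^ (-z - 1))
        (Set.Icc ((n + 1 : ℕ) : ℝ) ((n + 2 : ℕ) : ℝ)) x := fun x hx => by
    have hx0 : 0 < x := lt_of_lt_of_le (by positivity) hx.1
    have h := ((hasDerivAt_id (x : ℂ)).cpow_const (c := -z)
      (Or.inl (by simpa using hx0))).comp_ofReal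
    simpa using h.hasDerivWithinAt
  have hbound : ∀ x ∈ Set.Ico ((n + 1 : ℕ) : ℝ) ((n + 2 : ℕ) : ℝ),
      ‖-z * (x : ℂ) ^ (-z - 1)‖ ≤ ‖z‖ * ((n + 1 : ℕ) : ℝ) ^ (-z.re - 1) := fun x hx => by
    have hn : (0 : ℝ) < ((n + 1 : ℕ) : ℝ) := by positivity
    have hx0 : 0 < x := lt_of_lt_of_le hn hx.1
    rw [norm_mul, norm_neg, Complex.norm_cpow_eq_rpow_re_of_pos hx0]
    refine mul_le_mul_of_nonneg_left ?_ (norm_nonneg z)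
    exact Real.rpow_le_rpow_of_nonpos hn hx.1 (by simp; linarith)
  have h := norm_image_sub_le_of_norm_deriv_le_segment' hderiv hbound _
    (Set.right_mem_Icc.2 (by norm_cast; omega))
  have h1 : ((n + 2 : ℕ) : ℝ) - ((n + 1 : ℕ) : ℝ) = 1 := by push_cast; ring
  rw [h1, mul_one] at h
  simpa only [Complex.ofReal_natCast] using h

/-- A Dirichlet series that converges at a point `r` is, to the right of `r`, the sum of a series
of entire functions that converges absolutely and locally uniformly. -/
theorem differentiableOn_dirichletSum {f : ℕ+ → ℂ} {r : ℝ}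
    (hr : ∃ w, Tendsto (partialSum f r) atTop (𝓝 w)) :
    DifferentiableOn ℂ (dirichletSum f) {s | r < s.re} := by
  obtain ⟨w, hw⟩ := hr
  obtain ⟨C, hC⟩ := hw.norm.bddAbove_range
  have hA : ∀ N, ‖partialSum f r N‖ ≤ C := fun N => hC ⟨N, rfl⟩
  have hC0 : 0 ≤ C := (norm_nonneg _).trans (hA 0)
  set v : ℕ → ℂ → ℂ := fun n s => ((n + 1 : ℕ) : ℂ) ^ (-(s - r)) with hv
  set G : ℕ → ℂ → ℂ := fun n s => partialSum f r (n + 1) * (v (n + 1) s - v n s) with hG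
  -- Abel summation.
  have hparts : ∀ (s : ℂ) (N : ℕ),
      partialSum f s N = partialSum f r N * v N s - ∑ n ∈ Finset.range N, G n s := by
    intro s N
    induction N with
    | zero => simp [partialSum]
    | succ N ih =>
      have hstep : ∀ s, partialSum f s (N + 1) =
          partialSum f s N + f N.succPNat * ((N + 1 : ℕ) : ℂ) ^ (-s) := fun s =>
        Finset.sum_range_succ _ _
      have hpow : ((N + 1 : ℕ) : ℂ) ^ (-s) = ((N + 1 : ℕ) : ℂ) ^ (-(r : ℂ)) * v N s := by
        rw [hv, ← Complex.cpow_add _ _ (Nat.cast_ne_zero.2 N.succ_ne_zero)]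
        congr 1
        ring
      rw [Finset.sum_range_succ, hstep s, ih, hpow, hG]
      simp only [hstep r]
      ring
  have hGle : ∀ {δ R : ℝ} (n : ℕ) {s : ℂ}, 0 < δ → δ < s.re - r → ‖s - r‖ < R →
      ‖G n s‖ ≤ C * (R * ((n + 1 : ℕ) : ℝ) ^ (-δ - 1)) := by
    intro δ R n s hδ hδs hR
    have hre : (s - r).re = s.re - r := by simp
    rw [hG, norm_mul]
    refine mul_le_mul (hA _) ((norm_cpow_sub_cpow_le (by rw [hre]; linarith) n).trans
      (mul_le_mul hR.le ?_ (by positivity) ((norm_nonneg _).trans hR.le))) (norm_nonneg _) hC0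
    exact Real.rpow_le_rpow_of_exponent_le (by norm_cast; omega) (by rw [hre]; linarith)
  have hsum : ∀ {δ R : ℝ}, 0 < δ →
      Summable fun n : ℕ => C * (R * ((n + 1 : ℕ) : ℝ) ^ (-δ - 1)) := fun {δ R} hδ =>
    (((summable_nat_add_iff 1).2 (Real.summable_nat_rpow.2 (by linarith))).mul_left R).mul_left C
  have heq : ∀ s ∈ {s : ℂ | r < s.re}, dirichletSum f s = -∑' n, G n s := by
    intro s hs
    have hs' : r < s.re := hs
    refine Tendsto.limUnder_eq ?_
    have h1 : Summable fun n => G n s := by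
      refine Summable.of_norm_bounded (hsum (δ := (s.re - r) / 2) (R := ‖s - r‖ + 1)
        (by linarith)) fun n => hGle n (by linarith) (by linarith) (by linarith)
    have h2 : Tendsto (fun N => v N s) atTop (𝓝 0) := by
      rw [tendsto_zero_iff_norm_tendsto_zero]
      have h3 : Tendsto (fun N : ℕ => ((N + 1 : ℕ) : ℝ) ^ (-(s.re - r))) atTop (𝓝 0) :=
        (tendsto_rpow_neg_atTop (by linarith)).comp
          (tendsto_natCast_atTop_atTop.comp (tendsto_add_atTop_nat 1))
      refine h3.congr fun N => ?_
      rw [hv, Complex.norm_natCast_cpow_of_pos N.succ_pos]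
      simp
    have h3 := (hw.mul h2).sub h1.hasSum.tendsto_sum_nat
    rw [mul_zero, zero_sub] at h3
    exact h3.congr fun N => (hparts s N).symm
  refine DifferentiableOn.congr (fun s hs => ?_) heq
  have hs' : r < s.re := hs
  set V : Set ℂ := {z | (s.re - r) / 2 < z.re - r} ∩ {z | ‖z - r‖ < ‖s - r‖ + 1} with hV
  have hVo : IsOpen V :=
    (isOpen_lt continuous_const (Complex.continuous_re.sub continuous_const)).inter
      (isOpen_lt (continuous_id.sub continuous_const).norm continuous_const)
  have hsV : s ∈ V := ⟨by simp only [Set.mem_ofPred_eq]; linarith, by simp⟩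
  have hd : DifferentiableOn ℂ (fun z => ∑' n, G n z) V := by
    refine Complex.differentiableOn_tsum_of_summable_norm
      (hsum (δ := (s.re - r) / 2) (R := ‖s - r‖ + 1) (by linarith)) (fun n => ?_) hVo
      fun n z hz => hGle n (by linarith) hz.1 hz.2
    have hvd : ∀ n, Differentiable ℂ (v n) := fun n z =>
      ((differentiableAt_id.sub_const _).neg).const_cpow
        (Or.inl (Nat.cast_ne_zero.2 n.succ_ne_zero))
    exact (((hvd (n + 1)).sub (hvd n)).const_mul _).differentiableOn
  exact (hd.differentiableAt (hVo.mem_nhds hsV)).neg.differentiableWithinAt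

/-! ### The equation on the half-plane of convergence -/

theorem tendsto_partialSum_phiCoeff {s : ℂ} (hs : 3 ≤ s.re) :
    Tendsto (partialSum phiCoeff s) atTop (𝓝 (LSeries (phi ·) s)) :=
  tendsto_partialSum_of_LSeriesSummable phiCoeff_eq (LSeriesSummable_phi hs)

theorem convAbscissa_phiCoeff_lt_top : convAbscissa phiCoeff < ⊤ :=
  lt_of_le_of_lt (sInf_le (a := ((3 : ℝ) : EReal)) fun _ hs =>
    ⟨_, tendsto_partialSum_phiCoeff (EReal.coe_lt_coe_iff.1 hs).le⟩) (EReal.coe_lt_top 3)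

theorem dirichletSum_phiCoeff_quadratic {s : ℂ}
    (hs : max 1 (convAbscissa phiCoeff) < (s.re : EReal)) :
    Tendsto (partialSum phiCoeff s) atTop (𝓝 (dirichletSum phiCoeff s)) ∧
      (riemannZeta s - 1) * dirichletSum phiCoeff s ^ 2 + riemannZeta s * dirichletSum phiCoeff s
        - riemannZeta s * (riemannZeta s - 1) = 0 := by
  obtain ⟨σ, hσ, hσs⟩ := sInf_lt_iff.1 ((le_max_right _ _).trans_lt hs)
  -- Everything takes place on the half-plane `r < re z`; the series also converges at `r` itself.
  obtain ⟨r, hr, hrs⟩ := EReal.lt_iff_exists_real_btwn.1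
    (max_lt ((le_max_left _ _).trans_lt hs) hσs)
  have hr1 : 1 < r := by exact_mod_cast (le_max_left _ _).trans_lt hr
  have hconv : ∀ z : ℂ, r ≤ z.re →
      Tendsto (partialSum phiCoeff z) atTop (𝓝 (dirichletSum phiCoeff z)) := fun z hz =>
    tendsto_nhds_limUnder (hσ z (((le_max_right _ _).trans_lt hr).trans_le
      (EReal.coe_le_coe_iff.2 hz)))
  have hs' : r < s.re := EReal.coe_lt_coe_iff.1 hrs
  refine ⟨hconv s hs'.le, ?_⟩
  set U : Set ℂ := {z | r < z.re} with hU
  have hUo : IsOpen U := isOpen_lt continuous_const Complex.continuous_re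
  have hφ : DifferentiableOn ℂ (dirichletSum phiCoeff) U :=
    differentiableOn_dirichletSum ⟨_, hconv r (by simp)⟩
  have hζ : DifferentiableOn ℂ riemannZeta U := fun z hz =>
    (differentiableAt_riemannZeta (by rintro rfl; simp [hU] at hz; linarith)).differentiableWithinAt
  have hF : DifferentiableOn ℂ (fun z => (riemannZeta z - 1) * dirichletSum phiCoeff z ^ 2
      + riemannZeta z * dirichletSum phiCoeff z - riemannZeta z * (riemannZeta z - 1)) U :=
    (((hζ.sub_const 1).mul (hφ.pow 2)).add (hζ.mul hφ)).sub (hζ.mul (hζ.sub_const 1))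
  set x : ℂ := ((r + 3 : ℝ) : ℂ) with hx
  have hxU : x ∈ U := by simp [hU, hx]
  refine (hF.analyticOnNhd hUo).eqOn_zero_of_preconnected_of_eventuallyEq_zero
    (convex_halfSpace_re_gt r).isPreconnected hxU ?_ hs'
  have hnear : ∀ᶠ z in 𝓝 x, 3 < z.re :=
    (isOpen_lt continuous_const Complex.continuous_re).mem_nhds (by simp [hx]; linarith)
  filter_upwards [hnear] with z hz
  rw [show dirichletSum phiCoeff z = LSeries (phi ·) z from
    (tendsto_partialSum_phiCoeff hz.le).limUnder_eq]
  exact LSeries_phi_quadratic hz.le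

end DivisorMatrix

theorem mainTheorem5 :
    DivisorMatrix.convAbscissa DivisorMatrix.phiCoeff < ⊤ ∧
    ∀ s : ℂ, max 1 (DivisorMatrix.convAbscissa DivisorMatrix.phiCoeff) < (s.re : EReal) →
      Tendsto (DivisorMatrix.partialSum DivisorMatrix.phiCoeff s) atTop (𝓝 (DivisorMatrix.dirichletSum DivisorMatrix.phiCoeff s)) ∧
      (riemannZeta s - 1) * DivisorMatrix.dirichletSum DivisorMatrix.phiCoeff s ^ 2
        + riemannZeta s * DivisorMatrix.dirichletSum DivisorMatrix.phiCoeff s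
        - riemannZeta s * (riemannZeta s - 1) = 0 :=
  ⟨DivisorMatrix.convAbscissa_phiCoeff_lt_top,
    fun _ hs => DivisorMatrix.dirichletSum_phiCoeff_quadratic hs⟩
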